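/- **Definitions.** Let $dA$ be Lebesgue measure on $\mathbb C$, $H(\mathbb C)$ the space of entire functions, $D(u,1)$ the disc with center $u$ and radius $1$, and $|E|$ the area of a measurable set $E$. A weight is a locally integrable function $\omega:\mathbb C\to[0,\infty)$; we write $\omega(E)=\int_E\omega\,dA$. For $1<p<\infty$, with $\frac1p+\frac1{p'}=1$, a weight $\omega$ belongs to $A_p^{restricted}$ if $\omega>0$ a.e. and, for some $r>0$, $$\sup_{Q}\Big(\frac1{|Q|}\int_Q\omega\,dA\Big)\Big(\frac1{|Q|}\int_Q\omega^{-p'/p}\,dA\Big)^{p/p'}<\infty,$$ where $Q$ runs over all squares of side length $r$ (with sides parallel to the coordinate axes). It belongs to $A_1^{restricted}$ if $\omega>0$ a.e. and, for some $r>0$, there is a constant $C$ such that $\omega(Q)/|Q|\le C\,\omega(u)$ for a.e. $u\in Q$, for every such square $Q$. Let $A_\infty^{restricted}=\bigcup_{1\le p<\infty}A_p^{restricted}$. For $0<p<\infty$ and $\alpha>0$ let $$\mathcal F^p_{\alpha,\omega}=\Big\{f\in H(\mathbb C):\int_{\mathbb C}|f(z)|^pe^{-p\frac{\alpha}{2}|z|^2}\omega(z)\,dA(z)<\infty\Big\},\qquad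 \mathcal F^\infty_{\alpha}=\Big\{f\in H(\mathbb C):\sup_{z\in\mathbb C}|f(z)|e^{-\frac{\alpha}{2}|z|^2}<\infty\Big\}.$$ For spaces $X,Y$ of functions on $\mathbb C$, let $Mult(X,Y)$ be the set of all functions $g:\mathbb C\to\mathbb C$ such that $gf\in Y$ for every $f\in X$. **Theorem.** Let $\alpha,\beta>0$, $\omega\in A_\infty^{restricted}$ and $0<p,q<\infty$. Then: 1. If $\alpha<\beta$, then $Mult(\mathcal F^p_{\alpha,\omega},\mathcal F^p_{\beta,\omega})=\mathcal F^\infty_{\beta-\alpha}$. 2. $Mult(\mathcal F^p_{\alpha,\omega},\mathcal F^p_{\alpha,\omega})$ is the set of constant functions. 3. If $q>p$ and $\alpha\le\beta$, then $g\in Mult(\mathcal F^p_{\alpha,\omega},\mathcal F^q_{\beta,\omega})$ if and only if $g\in H(\mathbb C)$ and there is a constant $C>0$ such that $$|g(u)|\,e^{\frac{\alpha-\beta}{2}|u|^2}\le C\,\omega(D(u,1))^{\frac{q-p}{pq}}\qquad\text{for all }u\in\mathbb C.$$ 4. If $p>q$ and $\alpha<\beta$, then $Mult(\mathcal F^p_{\alpha,\omega},\mathcal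 F^q_{\beta,\omega})=\mathcal F^{pq/(p-q)}_{\beta-\alpha,\omega}$. 5. If $p>q$, then $Mult(\mathcal F^p_{\alpha,\omega},\mathcal F^q_{\alpha,\omega})=H(\mathbb C)\cap L^{pq/(p-q)}(\mathbb C,\omega\,dA)$. -/

import Mathlib

open MeasureTheory
open scoped ENNReal

noncomputable section

namespace WeightedFock

/-- A weight on `ℂ`: a nonnegative locally integrable function. -/
structure IsWeight (ω : ℂ → ℝ) : Prop where
  nonneg : ∀ z, 0 ≤ ω z
  locallyIntegrable : LocallyIntegrable ω (volume : Measure ℂ)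

/-- The measure `ω dA` on `ℂ`, where `dA` is Lebesgue measure. -/
def weightMeasure (ω : ℂ → ℝ) : Measure ℂ :=
  (volume : Measure ℂ).withDensity fun z => ENNReal.ofReal (ω z)

/-- The closed square with center `z`, sides parallel to the axes and side length `r`. -/
def square (z : ℂ) (r : ℝ) : Set ℂ :=
  {w | |w.re - z.re| ≤ r / 2 ∧ |w.im - z.im| ≤ r / 2}

/-- The quantity `(|Q|⁻¹ ∫_Q ω) (|Q|⁻¹ ∫_Q ω ^ (-p'/p)) ^ (p/p')` for a set `Q`, where `p'` is
the exponent conjugate to `p`. -/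
def muckenhouptProduct (p : ℝ) (ω : ℂ → ℝ) (Q : Set ℂ) : ℝ≥0∞ :=
  ((volume Q)⁻¹ * ∫⁻ w in Q, ENNReal.ofReal (ω w)) *
    ((volume Q)⁻¹ * ∫⁻ w in Q, ENNReal.ofReal (ω w) ^ (-(p.conjExponent / p))) ^
      (p / p.conjExponent)

/-- The class `A_{p,r}` for `1 < p < ∞`. -/
def IsApr (p r : ℝ) (ω : ℂ → ℝ) : Prop :=
  IsWeight ω ∧ (∀ᵐ z, 0 < ω z) ∧ (⨆ z : ℂ, muckenhouptProduct p ω (square z r)) < ∞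

/-- The class `A_{1,r}`. -/
def IsA1r (r : ℝ) (ω : ℂ → ℝ) : Prop :=
  IsWeight ω ∧ (∀ᵐ z, 0 < ω z) ∧
    ∃ C : ℝ, ∀ z : ℂ, ∀ᵐ u ∂(volume.restrict (square z r)),
      (weightMeasure ω).real (square z r) / (volume : Measure ℂ).real (square z r) ≤ C * ω u

/-- The class `A_p^restricted`, `1 ≤ p < ∞`: squares of some fixed side length are tested. -/
def IsApRestricted (p : ℝ) (ω : ℂ → ℝ) : Prop :=
  (p = 1 ∧ ∃ r : ℝ, 0 < r ∧ IsA1r r ω) ∨ (1 < p ∧ ∃ r : ℝ, 0 < r ∧ IsApr p r ω)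

/-- The class `A_∞^restricted`, the union of the classes `A_p^restricted`, `1 ≤ p < ∞`. -/
def IsAInftyRestricted (ω : ℂ → ℝ) : Prop :=
  ∃ p : ℝ, 1 ≤ p ∧ IsApRestricted p ω

/-- The space `H(ℂ)` of entire functions. -/
def entire : Set (ℂ → ℂ) := {f | Differentiable ℂ f}

/-- The space `𝓛^p_{α,ω}` of measurable functions `f` with
`∫ |f(z)|^p e^{-p α |z|² / 2} ω(z) dA(z) < ∞`. -/
def lebesgueSpace (p α : ℝ) (ω : ℂ → ℝ) : Set (ℂ → ℂ) :=
  {f | AEStronglyMeasurable f (volume : Measure ℂ) ∧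
    ∫⁻ z : ℂ, ENNReal.ofReal
      (‖f z‖ ^ p * Real.exp (-(p * (α / 2) * ‖z‖ ^ 2)) * ω z) < ∞}

/-- The weighted Fock space `F^p_{α,ω} = 𝓛^p_{α,ω} ∩ H(ℂ)`. -/
def fockSpace (p α : ℝ) (ω : ℂ → ℝ) : Set (ℂ → ℂ) :=
  lebesgueSpace p α ω ∩ entire

/-- The Fock space `F^∞_γ` of entire functions `f` with `sup_z |f(z)| e^{-γ |z|² / 2} < ∞`. -/
def fockSpaceInfty (γ : ℝ) : Set (ℂ → ℂ) :=
  {f | f ∈ entire ∧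
    BddAbove (Set.range fun z : ℂ => ‖f z‖ * Real.exp (-(γ / 2 * ‖z‖ ^ 2)))}

/-- The pointwise multipliers from the function space `X` to the function space `Y`. -/
def Mult (X Y : Set (ℂ → ℂ)) : Set (ℂ → ℂ) :=
  {g | ∀ f ∈ X, (fun z => g z * f z) ∈ Y}

end WeightedFock

end

namespace WeightedFock

/-! Write |f|_α for |f(z)| exp(-α|z|²/2) and μ for ω dA. Since |gf|_β = |g|_{β-α} |f|_α, each
assertion concerns the size of |g|_{β-α} alone. The weight enters through `IsMuckenhoupt`: (∫_Q h)^P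
μ(Q) ≤ C ∫_Q h^P dμ on all squares Q of one fixed side r. With h an indicator this makes nearby
squares comparable in mass, so the masses of the tiles of a grid grow at most exponentially in the
lattice distance. With h a power of the modulus of an entire function it gives the weighted sub-mean
value inequality `exists_weightedModulus_rpow_le`.

Sufficiency is direct. For p = q, |g|_{β-α} is bounded. For p < q, the sub-mean value inequality
bounds |f|_α^p by a multiple of μ(D(w,1))⁻¹ pointwise, and this is spent on |f|_α^{q-p}. For p > q,
with s = pq/(p-q), so that 1/q = 1/s + 1/p, one has (ab)^q ≤ a^s + b^p.

Necessity rests on `tsum_ne_top_of_multiplier`: if Σ x_n μ(Q_n) < ∞ over the tiles Q_n and z_n ∈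
Q_n, then Σ x_n^{q/p} |g(z_n)|_{β-α}^q μ(Q_n) < ∞. The test functions are sums of normalized
reproducing kernels at the z_n with coefficients y_n^{1/p}, where y ≥ x is still summable against
the masses but varies at most exponentially (`exists_slowly_varying_majorant`). Gaussian decay beats
this variation, so |f|_α is at most of order y_m^{1/p} on Q_m. If the kernels are restricted to a
sparse residue class, each one dominates near its own point (`exists_fock_interpolant`).

A uniform boundedness argument for sequences (`exists_bound_of_tsum_ne_top`), needing no norm and
hence valid for all positive exponents, makes the implication quantitative. With z_n a maximum point
of |g|_{β-α} on Q_n, testing on one tile settles p ≤ q, and testing on the extremal sequence of ℓ^p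
duality settles p > q. Liouville's theorem then identifies the multipliers when α = β and p = q. -/

/-! ### Sub-mean value inequalities for powers of entire functions -/

theorem enorm_mul_two_pi_le_lintegral_circle {F : ℂ → ℂ} (hF : Differentiable ℂ F) (z w : ℂ) :
    ‖F z‖ₑ * ENNReal.ofReal (2 * Real.pi) ≤
      ∫⁻ θ in Set.Ioc 0 (2 * Real.pi), ‖F (z + circleMap 0 1 θ * w)‖ₑ := by
  have hH : Differentiable ℂ fun u : ℂ => F (z + u * w) := by fun_prop
  have h1 : Real.circleAverage (fun u : ℂ => F (z + u * w)) 0 1 = F z := by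
    rw [DiffContOnCl.circleAverage hH.diffContOnCl]; simp
  have h2 : ∫ θ in Set.Ioc 0 (2 * Real.pi), F (z + circleMap 0 1 θ * w)
      = (2 * Real.pi : ℝ) • F z := by
    rw [← h1, Real.circleAverage_def, smul_smul, mul_inv_cancel₀ (by positivity), one_smul,
      intervalIntegral.integral_of_le (by positivity)]
  have h3 := enorm_integral_le_lintegral_enorm (μ := volume.restrict (Set.Ioc 0 (2 * Real.pi)))
    fun θ => F (z + circleMap 0 1 θ * w)
  rw [h2, enorm_smul, Real.enorm_eq_ofReal (by positivity), mul_comm] at h3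
  exact h3

theorem lintegral_ball_rotation (f : ℂ → ℝ≥0∞) {a : ℂ} (ha : ‖a‖ = 1) (ρ : ℝ) :
    ∫⁻ w in Metric.ball 0 ρ, f (a * w) = ∫⁻ w in Metric.ball 0 ρ, f w := by
  have hmp := (rotation ⟨a, mem_sphere_zero_iff_norm.2 ha⟩).measurePreserving
  have := hmp.setLIntegral_comp_preimage_emb
    (rotation ⟨a, mem_sphere_zero_iff_norm.2 ha⟩).toHomeomorph.measurableEmbedding
    f (Metric.ball 0 ρ)
  have hpre : (rotation ⟨a, mem_sphere_zero_iff_norm.2 ha⟩) ⁻¹' (Metric.ball 0 ρ)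
      = Metric.ball (0 : ℂ) ρ := by
    ext w; simp
  rw [hpre] at this
  exact this

/-- The area sub-mean value inequality for the modulus of an entire function. -/
theorem enorm_mul_volume_ball_le {F : ℂ → ℂ} (hF : Differentiable ℂ F) (z : ℂ) (ρ : ℝ) :
    ‖F z‖ₑ * volume (Metric.ball z ρ) ≤ ∫⁻ w in Metric.ball z ρ, ‖F w‖ₑ := by
  have htrans : ∫⁻ w in Metric.ball z ρ, ‖F w‖ₑ = ∫⁻ w in Metric.ball 0 ρ, ‖F (z + w)‖ₑ := by
    have := (measurePreserving_add_left (volume : Measure ℂ) z).setLIntegral_comp_preimage_emb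
      (measurableEmbedding_addLeft z) (fun w => ‖F w‖ₑ) (Metric.ball z ρ)
    rw [← this]
    congr 2
    ext w; simp
  have hpi : ENNReal.ofReal (2 * Real.pi) ≠ 0 := by simp [Real.pi_pos]
  have hcont : Continuous F := hF.continuous
  rw [htrans, ← ENNReal.mul_le_mul_iff_left hpi ENNReal.ofReal_ne_top]
  calc ‖F z‖ₑ * volume (Metric.ball z ρ) * ENNReal.ofReal (2 * Real.pi)
      = ∫⁻ w in Metric.ball (0 : ℂ) ρ, ‖F z‖ₑ * ENNReal.ofReal (2 * Real.pi) := by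
        rw [setLIntegral_const, Complex.volume_ball, Complex.volume_ball]; ring
    _ ≤ ∫⁻ w in Metric.ball (0 : ℂ) ρ, ∫⁻ θ in Set.Ioc 0 (2 * Real.pi),
          ‖F (z + circleMap 0 1 θ * w)‖ₑ :=
        lintegral_mono fun w => enorm_mul_two_pi_le_lintegral_circle hF z w
    _ = ∫⁻ θ in Set.Ioc 0 (2 * Real.pi), ∫⁻ w in Metric.ball (0 : ℂ) ρ,
          ‖F (z + circleMap 0 1 θ * w)‖ₑ := by
        apply lintegral_lintegral_swap
        have : Continuous fun p : ℂ × ℝ => ‖F (z + circleMap 0 1 p.2 * p.1)‖ₑ := by fun_prop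
        exact this.measurable.aemeasurable
    _ = ∫⁻ θ in Set.Ioc 0 (2 * Real.pi), ∫⁻ w in Metric.ball (0 : ℂ) ρ, ‖F (z + w)‖ₑ := by
        refine lintegral_congr fun θ => ?_
        exact lintegral_ball_rotation (fun w => ‖F (z + w)‖ₑ) (by simp) ρ
    _ = (∫⁻ w in Metric.ball (0 : ℂ) ρ, ‖F (z + w)‖ₑ) * ENNReal.ofReal (2 * Real.pi) := by
        rw [setLIntegral_const, Real.volume_Ioc, sub_zero]

/-- The sub-mean value inequality for small powers of the modulus of an entire function. -/
theorem enorm_rpow_le_lintegral_ball_of_le_one {t δ : ℝ} (ht : 0 < t) (ht1 : t ≤ 1) (hδ : 0 < δ) :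
    ∃ C : ℝ, 0 < C ∧ ∀ F : ℂ → ℂ, Differentiable ℂ F → ∀ z : ℂ,
      ‖F z‖ₑ ^ t ≤ ENNReal.ofReal C * ∫⁻ w in Metric.ball z δ, ‖F w‖ₑ ^ t := by
  refine ⟨((2 : ℝ) ^ (2 / t)) ^ (1 - t) * 4 / (Real.pi * δ ^ 2), by positivity, fun F hF z => ?_⟩
  rcases eq_or_ne (F z) 0 with h0 | h0
  · simp [h0, ht]
  have hcont : Continuous F := hF.continuous
  have h2t : 0 < 2 / t := by positivity
  -- For t ≤ 1, the mean value inequality is applied at a maximum point w₀ of the modulus damped by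
  -- a power of the distance to the boundary. The exponent 2/t turns into 2 after taking t-th
  -- powers, matching the area of a disc.
  obtain ⟨w₀, hw₀, hmax⟩ := (isCompact_closedBall z δ).exists_isMaxOn
    ⟨z, Metric.mem_closedBall_self hδ.le⟩
    (f := fun w => ‖F w‖ * (δ - ‖w - z‖) ^ (2 / t)) (by
      apply Continuous.continuousOn
      exact hcont.norm.mul (Continuous.rpow_const (by fun_prop) fun _ => Or.inr h2t.le))
  have hw₀' : ‖w₀ - z‖ ≤ δ := by simpa [dist_eq_norm] using hw₀
  have hz := hmax (Metric.mem_closedBall_self hδ.le)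
  simp only [Set.mem_ofPred_eq, sub_self, norm_zero, sub_zero] at hz
  have hpos : 0 < ‖F w₀‖ * (δ - ‖w₀ - z‖) ^ (2 / t) := lt_of_lt_of_le (by positivity) hz
  have hM : 0 < ‖F w₀‖ := by
    by_contra h
    rw [le_antisymm (not_lt.1 h) (norm_nonneg _), zero_mul] at hpos
    exact lt_irrefl _ hpos
  -- On the disc of radius ρ about w₀ the distance to the boundary at least halves its value at w₀
  -- at worst, so maximality costs only the factor 2^(2/t).
  obtain ⟨ρ, hρ⟩ : ∃ ρ, δ - ‖w₀ - z‖ = 2 * ρ := ⟨(δ - ‖w₀ - z‖) / 2, by ring⟩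
  have hρ0 : 0 < ρ := by
    rcases (sub_nonneg.2 hw₀').lt_or_eq with h | h
    · linarith
    · rw [← h, Real.zero_rpow h2t.ne', mul_zero] at hpos; exact absurd hpos (lt_irrefl _)
  rw [hρ] at hz hpos
  have hsub : Metric.ball w₀ ρ ⊆ Metric.ball z δ := by
    intro w hw
    rw [Metric.mem_ball, dist_eq_norm] at hw ⊢
    have := norm_sub_le_norm_sub_add_norm_sub w w₀ z
    linarith
  set A : ℝ := 2 ^ (2 / t) with hA
  have hA0 : 0 < A := by positivity
  have hbound : ∀ w ∈ Metric.ball w₀ ρ, ‖F w‖ ≤ A * ‖F w₀‖ := by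
    intro w hw
    have hwz := hmax (Metric.ball_subset_closedBall (hsub hw))
    simp only [Set.mem_ofPred_eq] at hwz
    rw [hρ, Real.mul_rpow (by norm_num) hρ0.le] at hwz
    rw [Metric.mem_ball, dist_eq_norm] at hw
    have := norm_sub_le_norm_sub_add_norm_sub w w₀ z
    have h1 : ρ ^ (2 / t) ≤ (δ - ‖w - z‖) ^ (2 / t) :=
      Real.rpow_le_rpow hρ0.le (by linarith) h2t.le
    have h2 : 0 < ρ ^ (2 / t) := by positivity
    have h3 : ‖F w‖ * ρ ^ (2 / t) ≤ (A * ‖F w₀‖) * ρ ^ (2 / t) := by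
      calc _ ≤ ‖F w‖ * (δ - ‖w - z‖) ^ (2 / t) := by gcongr
        _ ≤ _ := hwz
        _ = _ := by ring
    exact le_of_mul_le_mul_right h3 h2
  -- Bounding the power 1 - t of the modulus by its near-maximal value lowers the exponent under the
  -- integral from 1 to t.
  have hpt : ∀ w ∈ Metric.ball w₀ ρ,
      ‖F w‖ₑ ≤ ENNReal.ofReal ((A * ‖F w₀‖) ^ (1 - t)) * ‖F w‖ₑ ^ t := by
    intro w hw
    rw [← ofReal_norm, ENNReal.ofReal_rpow_of_nonneg (norm_nonneg _) ht.le,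
      ← ENNReal.ofReal_mul (by positivity)]
    apply ENNReal.ofReal_le_ofReal
    calc ‖F w‖ = ‖F w‖ ^ (1 - t) * ‖F w‖ ^ t := by
          rw [← Real.rpow_add' (norm_nonneg _) (by simp)]; simp
      _ ≤ _ := by
          gcongr
          exact hbound w hw
  set I := ∫⁻ w in Metric.ball z δ, ‖F w‖ₑ ^ t with hI
  have hmean : ENNReal.ofReal (‖F w₀‖ * (Real.pi * ρ ^ 2)) ≤
      ENNReal.ofReal ((A * ‖F w₀‖) ^ (1 - t)) * I := by
    calc ENNReal.ofReal (‖F w₀‖ * (Real.pi * ρ ^ 2))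
        = ‖F w₀‖ₑ * volume (Metric.ball w₀ ρ) := by
          rw [ENNReal.ofReal_mul (norm_nonneg _), ofReal_norm, Complex.volume_ball,
            mul_comm Real.pi, ENNReal.ofReal_mul (by positivity), ENNReal.ofReal_pow hρ0.le,
            ← NNReal.coe_real_pi, ENNReal.ofReal_coe_nnreal]
      _ ≤ ∫⁻ w in Metric.ball w₀ ρ, ‖F w‖ₑ := enorm_mul_volume_ball_le hF w₀ ρ
      _ ≤ ∫⁻ w in Metric.ball w₀ ρ, ENNReal.ofReal ((A * ‖F w₀‖) ^ (1 - t)) * ‖F w‖ₑ ^ t :=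
          setLIntegral_mono' measurableSet_ball hpt
      _ = ENNReal.ofReal ((A * ‖F w₀‖) ^ (1 - t)) * ∫⁻ w in Metric.ball w₀ ρ, ‖F w‖ₑ ^ t :=
          lintegral_const_mul' _ _ ENNReal.ofReal_ne_top
      _ ≤ _ := by
          gcongr
          exact lintegral_mono_set hsub
  have hzt : ‖F z‖ ^ t * δ ^ 2 ≤ ‖F w₀‖ ^ t * (4 * ρ ^ 2) := by
    have h := Real.rpow_le_rpow (by positivity) hz ht.le
    rw [Real.mul_rpow (by positivity) (by positivity), Real.mul_rpow (by positivity) (by positivity),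
      ← Real.rpow_mul hδ.le, ← Real.rpow_mul (by positivity), div_mul_cancel₀ _ ht.ne',
      Real.rpow_two, Real.rpow_two] at h
    calc _ ≤ _ := h
      _ = _ := by ring
  have hfac : 0 < ‖F w₀‖ ^ (1 - t) := by positivity
  have hreal : ‖F z‖ ^ t ≤
      4 / (Real.pi * δ ^ 2 * ‖F w₀‖ ^ (1 - t)) * (‖F w₀‖ * (Real.pi * ρ ^ 2)) := by
    rw [div_mul_eq_mul_div, le_div_iff₀ (by positivity)]
    have hsplit : ‖F w₀‖ = ‖F w₀‖ ^ t * ‖F w₀‖ ^ (1 - t) := by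
      rw [← Real.rpow_add hM]; simp
    calc ‖F z‖ ^ t * (Real.pi * δ ^ 2 * ‖F w₀‖ ^ (1 - t))
        = (‖F z‖ ^ t * δ ^ 2) * (Real.pi * ‖F w₀‖ ^ (1 - t)) := by ring
      _ ≤ (‖F w₀‖ ^ t * (4 * ρ ^ 2)) * (Real.pi * ‖F w₀‖ ^ (1 - t)) := by gcongr
      _ = 4 * ((‖F w₀‖ ^ t * ‖F w₀‖ ^ (1 - t)) * (Real.pi * ρ ^ 2)) := by ring
      _ = _ := by rw [← hsplit]
  calc ‖F z‖ₑ ^ t = ENNReal.ofReal (‖F z‖ ^ t) := by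
        rw [← ofReal_norm, ENNReal.ofReal_rpow_of_nonneg (norm_nonneg _) ht.le]
    _ ≤ ENNReal.ofReal (4 / (Real.pi * δ ^ 2 * ‖F w₀‖ ^ (1 - t))) *
          ENNReal.ofReal (‖F w₀‖ * (Real.pi * ρ ^ 2)) := by
        rw [← ENNReal.ofReal_mul (by positivity)]
        exact ENNReal.ofReal_le_ofReal hreal
    _ ≤ ENNReal.ofReal (4 / (Real.pi * δ ^ 2 * ‖F w₀‖ ^ (1 - t))) *
          (ENNReal.ofReal ((A * ‖F w₀‖) ^ (1 - t)) * I) := by gcongr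
    _ = ENNReal.ofReal (A ^ (1 - t) * 4 / (Real.pi * δ ^ 2)) * I := by
        rw [← mul_assoc, ← ENNReal.ofReal_mul (by positivity)]
        congr 2
        rw [Real.mul_rpow hA0.le hM.le]
        field_simp

/-- The sub-mean value inequality for powers of the modulus of an entire function. -/
theorem enorm_rpow_le_lintegral_ball {t δ : ℝ} (ht : 0 < t) (hδ : 0 < δ) :
    ∃ C : ℝ, 0 < C ∧ ∀ F : ℂ → ℂ, Differentiable ℂ F → ∀ z : ℂ,
      ‖F z‖ₑ ^ t ≤ ENNReal.ofReal C * ∫⁻ w in Metric.ball z δ, ‖F w‖ₑ ^ t := by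
  -- The power F^m is entire and |F|^t = |F^m|^(t/m) with t/m ≤ 1.
  obtain ⟨m, hm⟩ := exists_nat_gt t
  have hm0 : 0 < (m : ℝ) := ht.trans hm
  obtain ⟨C, hC, h⟩ := enorm_rpow_le_lintegral_ball_of_le_one (t := t / m) (by positivity)
    ((div_le_one hm0).2 hm.le) hδ
  refine ⟨C, hC, fun F hF z => ?_⟩
  have key : ∀ w, ‖F w ^ m‖ₑ ^ (t / m) = ‖F w‖ₑ ^ t := by
    intro w
    rw [enorm_pow, ← ENNReal.rpow_natCast, ← ENNReal.rpow_mul, mul_div_cancel₀ _ hm0.ne']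
  simpa only [key] using h (fun w => F w ^ m) (hF.pow m) z

/-! ### Squares and Muckenhoupt conditions at a fixed scale -/

theorem square_eq_preimage (z : ℂ) (r : ℝ) :
    square z r = Complex.measurableEquivRealProd ⁻¹'
      (Set.Icc (z.re - r / 2) (z.re + r / 2) ×ˢ Set.Icc (z.im - r / 2) (z.im + r / 2)) := by
  ext w
  simp only [square, Set.mem_ofPred_eq, abs_le, Set.mem_preimage, Set.mem_prod, Set.mem_Icc,
    Complex.measurableEquivRealProd_apply]
  constructor <;> rintro ⟨⟨_, _⟩, _, _⟩ <;> refine ⟨⟨?_, ?_⟩, ?_, ?_⟩ <;> linarith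

theorem measurableSet_square (z : ℂ) (r : ℝ) : MeasurableSet (square z r) := by
  rw [square_eq_preimage]
  exact Complex.measurableEquivRealProd.measurable (measurableSet_Icc.prod measurableSet_Icc)

theorem volume_square (z : ℂ) (r : ℝ) :
    volume (square z r) = ENNReal.ofReal r * ENNReal.ofReal r := by
  rw [square_eq_preimage, Complex.volume_preserving_equiv_real_prod.measure_preimage
    (measurableSet_Icc.prod measurableSet_Icc).nullMeasurableSet, Measure.volume_eq_prod,
    Measure.prod_prod, Real.volume_Icc, Real.volume_Icc]
  ring_nf

theorem norm_sub_le_of_mem_square {z w : ℂ} {r : ℝ} (hw : w ∈ square z r) : ‖w - z‖ ≤ r := by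
  have := Complex.norm_le_abs_re_add_abs_im (w - z)
  have h := hw.1
  have h' := hw.2
  simp only [Complex.sub_re, Complex.sub_im] at this
  linarith

theorem mem_square_of_norm_sub_le {z w : ℂ} {r : ℝ} (hw : ‖w - z‖ ≤ r / 2) : w ∈ square z r :=
  ⟨(by simpa using Complex.abs_re_le_norm (w - z) : |w.re - z.re| ≤ ‖w - z‖).trans hw,
    (by simpa using Complex.abs_im_le_norm (w - z) : |w.im - z.im| ≤ ‖w - z‖).trans hw⟩

/-- A measure satisfying a Muckenhoupt condition with exponent `P` on the squares of side
length `r`: averages with respect to area are controlled by weighted averages. -/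
structure IsMuckenhoupt (μ : Measure ℂ) (r P : ℝ) : Prop where
  r_pos : 0 < r
  one_le : 1 ≤ P
  ne_zero : ∀ z, μ (square z r) ≠ 0
  ne_top : ∀ z, μ (square z r) ≠ ∞
  bound : ∃ C : ℝ≥0∞, C ≠ ∞ ∧ ∀ z : ℂ, ∀ h : ℂ → ℝ≥0∞, Measurable h →
    (∫⁻ w in square z r, h w) ^ P * μ (square z r) ≤ C * ∫⁻ w in square z r, h w ^ P ∂μ

section Weight

variable {ω : ℂ → ℝ}

theorem IsWeight.aemeasurable_ofReal (hω : IsWeight ω) :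
    AEMeasurable (fun z => ENNReal.ofReal (ω z)) volume :=
  hω.locallyIntegrable.aestronglyMeasurable.aemeasurable.ennreal_ofReal

theorem IsWeight.setLIntegral_weightMeasure (hω : IsWeight ω) (z : ℂ) (r : ℝ) (h : ℂ → ℝ≥0∞) :
    ∫⁻ w in square z r, h w ∂(weightMeasure ω) =
      ∫⁻ w in square z r, ENNReal.ofReal (ω w) * h w := by
  rw [weightMeasure, restrict_withDensity (measurableSet_square z r),
    lintegral_withDensity_eq_lintegral_mul_non_measurable₀ _ hω.aemeasurable_ofReal.restrict
      (by simp)]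
  rfl

theorem IsWeight.weightMeasure_square (hω : IsWeight ω) (z : ℂ) (r : ℝ) :
    weightMeasure ω (square z r) = ∫⁻ w in square z r, ENNReal.ofReal (ω w) := by
  simpa using hω.setLIntegral_weightMeasure z r (fun _ => 1)

theorem IsWeight.weightMeasure_ne_top (hω : IsWeight ω) {s : Set ℂ} {z : ℂ} {R : ℝ}
    (hs : s ⊆ Metric.closedBall z R) : weightMeasure ω s ≠ ∞ := by
  have hint := hω.locallyIntegrable.integrableOn_isCompact (isCompact_closedBall z R)
  refine ne_top_of_le_ne_top ?_ (measure_mono hs)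
  rw [weightMeasure, withDensity_apply _ measurableSet_closedBall]
  refine ne_top_of_le_ne_top hint.hasFiniteIntegral.ne (lintegral_mono fun w => ?_)
  rw [← ofReal_norm]
  exact ENNReal.ofReal_le_ofReal (le_abs_self _)

theorem square_subset_closedBall (z : ℂ) (r : ℝ) : square z r ⊆ Metric.closedBall z r :=
  fun w hw => by simpa [dist_eq_norm] using norm_sub_le_of_mem_square hw

theorem IsWeight.weightMeasure_square_ne_zero (hω : IsWeight ω) (hpos : ∀ᵐ z, 0 < ω z) (z : ℂ)
    {r : ℝ} (hr : 0 < r) : weightMeasure ω (square z r) ≠ 0 := by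
  rw [hω.weightMeasure_square]
  intro h
  rw [lintegral_eq_zero_iff' hω.aemeasurable_ofReal.restrict] at h
  have hfalse : ∀ᵐ w ∂(volume.restrict (square z r)), False := by
    filter_upwards [h, ae_restrict_of_ae hpos] with w hw hw'
    simp only [Pi.zero_apply, ENNReal.ofReal_eq_zero] at hw
    linarith
  rw [Filter.eventually_false_iff_eq_bot, ae_eq_bot, Measure.restrict_eq_zero, volume_square] at hfalse
  simp only [mul_self_eq_zero, ENNReal.ofReal_eq_zero] at hfalse
  linarith

/-- Multiply the pointwise bound of the mean of ω by h and integrate over the square. The constant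
uses |C| because C carries no sign condition. -/
theorem IsA1r.isMuckenhoupt {r : ℝ} (hr : 0 < r) (h : IsA1r r ω) :
    IsMuckenhoupt (weightMeasure ω) r 1 := by
  obtain ⟨hω, hpos, C, hC⟩ := h
  refine ⟨hr, le_rfl, fun z => hω.weightMeasure_square_ne_zero hpos z hr,
    fun z => hω.weightMeasure_ne_top (square_subset_closedBall z r),
    ENNReal.ofReal (|C| * (r * r)), ENNReal.ofReal_ne_top, fun z f hf => ?_⟩
  have hfin := hω.weightMeasure_ne_top (square_subset_closedBall z r)
  simp only [ENNReal.rpow_one]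
  rw [hω.setLIntegral_weightMeasure, mul_comm, ← lintegral_const_mul _ hf,
    ← lintegral_const_mul' _ _ ENNReal.ofReal_ne_top]
  refine lintegral_mono_ae ?_
  filter_upwards [hC z] with u hu
  rw [← mul_assoc]
  gcongr
  have hv : (volume : Measure ℂ).real (square z r) = r * r := by
    rw [Measure.real, volume_square, ← ENNReal.ofReal_mul hr.le,
      ENNReal.toReal_ofReal (by positivity)]
  rw [hv, div_le_iff₀ (by positivity)] at hu
  have hω0 := hω.nonneg u
  rw [← ENNReal.ofReal_toReal hfin, ← ENNReal.ofReal_mul (by positivity)]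
  apply ENNReal.ofReal_le_ofReal
  calc _ ≤ C * ω u * (r * r) := hu
    _ ≤ |C| * ω u * (r * r) := by gcongr; exact le_abs_self C
    _ = _ := by ring

/-- Hölder's inequality for h = (ω^(1/p) h) · ω^(-1/p); the dual factor is exactly what the
Muckenhoupt product controls. -/
theorem IsApr.isMuckenhoupt {p r : ℝ} (hp : 1 < p) (hr : 0 < r) (h : IsApr p r ω) :
    IsMuckenhoupt (weightMeasure ω) r p := by
  obtain ⟨hω, hpos, hM⟩ := h
  have hpq := Real.HolderConjugate.conjExponent hp
  set p' := p.conjExponent with hp'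
  have he : 0 < p / p' := div_pos hpq.pos hpq.symm.pos
  set M := ⨆ z : ℂ, muckenhouptProduct p ω (square z r) with hMdef
  set V := ENNReal.ofReal r * ENNReal.ofReal r with hV
  have hr' : ENNReal.ofReal r ≠ 0 := by simpa using hr
  have hV0 : V ≠ 0 := mul_ne_zero hr' hr'
  have hVt : V ≠ ∞ := ENNReal.mul_ne_top ENNReal.ofReal_ne_top ENNReal.ofReal_ne_top
  refine ⟨hr, hp.le, fun z => hω.weightMeasure_square_ne_zero hpos z hr,
    fun z => hω.weightMeasure_ne_top (square_subset_closedBall z r),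
    V * V ^ (p / p') * M, ?_, fun z f hf => ?_⟩
  · exact ENNReal.mul_ne_top (ENNReal.mul_ne_top hVt
      (ENNReal.rpow_ne_top_of_nonneg he.le hVt)) hM.ne
  set A := ∫⁻ w in square z r, ENNReal.ofReal (ω w) with hA
  set B := ∫⁻ w in square z r, ENNReal.ofReal (ω w) ^ (-(p' / p)) with hB
  set D := ∫⁻ w in square z r, ENNReal.ofReal (ω w) * f w ^ p with hD
  have hAB : A * B ^ (p / p') ≤ V * V ^ (p / p') * M := by
    have h1 : (V⁻¹ * A) * (V⁻¹ * B) ^ (p / p') ≤ M := by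
      have : muckenhouptProduct p ω (square z r) ≤ M :=
        le_iSup (fun z : ℂ => muckenhouptProduct p ω (square z r)) z
      simp only [muckenhouptProduct, volume_square] at this
      exact this
    calc A * B ^ (p / p') = (V * V⁻¹) * (V * V⁻¹) ^ (p / p') * (A * B ^ (p / p')) := by
          rw [ENNReal.mul_inv_cancel hV0 hVt]; simp
      _ = V * V ^ (p / p') * ((V⁻¹ * A) * (V⁻¹ * B) ^ (p / p')) := by
          rw [ENNReal.mul_rpow_of_nonneg V V⁻¹ he.le, ENNReal.mul_rpow_of_nonneg V⁻¹ B he.le]; ring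
      _ ≤ _ := by gcongr
  have hmeas : AEMeasurable (fun w => ENNReal.ofReal (ω w)) (volume.restrict (square z r)) :=
    hω.aemeasurable_ofReal.restrict
  have holder : (∫⁻ w in square z r, f w) ≤ D ^ (1 / p) * B ^ (1 / p') := by
    calc (∫⁻ w in square z r, f w)
        = ∫⁻ w in square z r, ((fun w => ENNReal.ofReal (ω w) ^ (1 / p) * f w) *
            fun w => ENNReal.ofReal (ω w) ^ (-(1 / p))) w := by
          refine lintegral_congr_ae ?_
          filter_upwards [ae_restrict_of_ae hpos] with w hw
          have h0 : ENNReal.ofReal (ω w) ≠ 0 := by simpa using hw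
          simp only [Pi.mul_apply]
          rw [mul_comm, ← mul_assoc, ← ENNReal.rpow_add _ _ h0 ENNReal.ofReal_ne_top,
            neg_add_cancel, ENNReal.rpow_zero, one_mul]
      _ ≤ (∫⁻ w in square z r, (ENNReal.ofReal (ω w) ^ (1 / p) * f w) ^ p) ^ (1 / p) *
            (∫⁻ w in square z r, (ENNReal.ofReal (ω w) ^ (-(1 / p))) ^ p') ^ (1 / p') :=
          ENNReal.lintegral_mul_le_Lp_mul_Lq _ hpq ((hmeas.pow_const _).mul hf.aemeasurable)
            (hmeas.pow_const _)
      _ = D ^ (1 / p) * B ^ (1 / p') := by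
          congr 2
          · refine lintegral_congr fun w => ?_
            rw [ENNReal.mul_rpow_of_nonneg _ _ hpq.nonneg, ← ENNReal.rpow_mul,
              one_div_mul_cancel hpq.ne_zero, ENNReal.rpow_one]
          · refine lintegral_congr fun w => ?_
            rw [← ENNReal.rpow_mul]
            congr 1
            ring
  rw [hω.setLIntegral_weightMeasure, hω.weightMeasure_square]
  calc (∫⁻ w in square z r, f w) ^ p * A ≤ (D ^ (1 / p) * B ^ (1 / p')) ^ p * A := by
        gcongr
    _ = A * B ^ (p / p') * D := by
        rw [ENNReal.mul_rpow_of_nonneg _ _ hpq.nonneg, ← ENNReal.rpow_mul, ← ENNReal.rpow_mul,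
          one_div_mul_cancel hpq.ne_zero, ENNReal.rpow_one, one_div_mul_eq_div]
        ring
    _ ≤ _ := by gcongr

theorem IsAInftyRestricted.isWeight (h : IsAInftyRestricted ω) : IsWeight ω := by
  obtain ⟨p, -, ⟨-, r, -, h⟩ | ⟨-, r, -, h⟩⟩ := h
  exacts [h.1, h.1]

theorem IsAInftyRestricted.isMuckenhoupt (h : IsAInftyRestricted ω) :
    ∃ r P : ℝ, IsMuckenhoupt (weightMeasure ω) r P := by
  obtain ⟨p, -, ⟨-, r, hr, h⟩ | ⟨hp, r, hr, h⟩⟩ := h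
  exacts [⟨r, 1, h.isMuckenhoupt hr⟩, ⟨r, p, h.isMuckenhoupt hp hr⟩]

end Weight

/-! ### The weighted modulus and comparability of masses -/

/-- The quantity `|f(z)| e^{-α|z|²/2}` as an extended nonnegative real number. -/
noncomputable def weightedModulus (α : ℝ) (f : ℂ → ℂ) (z : ℂ) : ℝ≥0∞ :=
  ENNReal.ofReal (‖f z‖ * Real.exp (-(α / 2 * ‖z‖ ^ 2)))

theorem continuous_weightedModulus {α : ℝ} {f : ℂ → ℂ} (hf : Continuous f) :
    Continuous (weightedModulus α f) :=
  ENNReal.continuous_ofReal.comp (by fun_prop)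

theorem weightedModulus_ne_top (α : ℝ) (f : ℂ → ℂ) (z : ℂ) : weightedModulus α f z ≠ ∞ :=
  ENNReal.ofReal_ne_top

theorem weightedModulus_mul (α β : ℝ) (f g : ℂ → ℂ) (z : ℂ) :
    weightedModulus β (fun z => g z * f z) z =
      weightedModulus (β - α) g z * weightedModulus α f z := by
  rw [weightedModulus, weightedModulus, weightedModulus, ← ENNReal.ofReal_mul (by positivity),
    norm_mul]
  congr 1
  rw [mul_mul_mul_comm, ← Real.exp_add]
  ring_nf

namespace IsMuckenhoupt

variable {μ : Measure ℂ} {r P : ℝ}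

/-- The Muckenhoupt bound tested on the indicator of E: a portion of definite area carries a
definite share of the mass. -/
theorem exists_measure_square_le (h : IsMuckenhoupt μ r P) {ε : ℝ≥0∞} (hε : ε ≠ 0) :
    ∃ K : ℝ≥0∞, K ≠ ∞ ∧ ∀ z : ℂ, ∀ E ⊆ square z r, MeasurableSet E → ε ≤ volume E →
      μ (square z r) ≤ K * μ E := by
  obtain ⟨C, hC, hb⟩ := h.bound
  have hP : 0 < P := zero_lt_one.trans_le h.one_le
  refine ⟨(ε ^ P)⁻¹ * C, ENNReal.mul_ne_top ?_ hC, fun z E hE hEm hEv => ?_⟩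
  · simpa [hP.le, hP] using hε
  have h1 := hb z (E.indicator 1) (measurable_one.indicator hEm)
  have h2 : ∫⁻ w in square z r, E.indicator 1 w ^ P ∂μ = μ E := by
    have : (fun w => (E.indicator 1 w : ℝ≥0∞) ^ P) = E.indicator 1 := by
      ext w; by_cases hw : w ∈ E <;> simp [hw, hP]
    rw [this, lintegral_indicator_one hEm, Measure.restrict_apply hEm,
      Set.inter_eq_left.2 hE]
  rw [h2, lintegral_indicator_one hEm, Measure.restrict_apply hEm, Set.inter_eq_left.2 hE] at h1
  have hεt : ε ≠ ∞ := ne_top_of_le_ne_top (by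
    rw [volume_square]; exact ENNReal.mul_ne_top ENNReal.ofReal_ne_top ENNReal.ofReal_ne_top)
    (hEv.trans (measure_mono hE))
  calc μ (square z r) = (ε ^ P)⁻¹ * (ε ^ P * μ (square z r)) := by
        rw [← mul_assoc, ENNReal.inv_mul_cancel, one_mul]
        · simp [hε, hεt]
        · simp [hεt, hP.le]
    _ ≤ (ε ^ P)⁻¹ * (volume E ^ P * μ (square z r)) := by gcongr
    _ ≤ (ε ^ P)⁻¹ * (C * μ E) := by gcongr
    _ = _ := by ring

/-- Two squares whose centers differ by at most r/2 in each coordinate share a square of side r/2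
centered at the midpoint. Distant squares are joined by a chain of such steps, one factor K each. -/
theorem exists_doubling (h : IsMuckenhoupt μ r P) :
    ∃ K : ℝ≥0∞, K ≠ ∞ ∧ 1 ≤ K ∧ ∀ (m : ℕ) (z w : ℂ), |z.re - w.re| ≤ m * (r / 2) →
      |z.im - w.im| ≤ m * (r / 2) → μ (square z r) ≤ K ^ m * μ (square w r) := by
  have hr := h.r_pos
  obtain ⟨K, hK, hb⟩ := h.exists_measure_square_le
    (ε := ENNReal.ofReal (r / 2) * ENNReal.ofReal (r / 2)) (by simpa using hr)
  refine ⟨K + 1, by simpa using hK, le_add_self, ?_⟩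
  have step : ∀ z w : ℂ, |z.re - w.re| ≤ r / 2 → |z.im - w.im| ≤ r / 2 →
      μ (square z r) ≤ (K + 1) * μ (square w r) := by
    intro z w h1 h2
    rw [abs_le] at h1 h2
    have hs : ∀ u : ℂ, u = z ∨ u = w →
        square ⟨(z.re + w.re) / 2, (z.im + w.im) / 2⟩ (r / 2) ⊆ square u r := by
      rintro u hu x ⟨hx1, hx2⟩
      simp only [abs_le] at hx1 hx2
      refine ⟨abs_le.2 ?_, abs_le.2 ?_⟩ <;> rcases hu with rfl | rfl <;> constructor <;> linarith
    calc μ (square z r) ≤ K * μ (square ⟨(z.re + w.re) / 2, (z.im + w.im) / 2⟩ (r / 2)) :=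
          hb z _ (hs z (Or.inl rfl)) (measurableSet_square _ _) (volume_square _ _).ge
      _ ≤ (K + 1) * μ (square w r) := by
          gcongr
          · exact le_self_add
          · exact hs w (Or.inr rfl)
  intro m
  induction m with
  | zero =>
    intro z w h1 h2
    have : z = w := by
      rw [Nat.cast_zero, zero_mul, abs_nonpos_iff, sub_eq_zero] at h1 h2
      exact Complex.ext h1 h2
    simp [this]
  | succ m ih =>
    intro z w h1 h2
    have hm : (0 : ℝ) < m + 1 := by positivity
    -- The last link of the chain starts at the point a fraction m/(m+1) of the way along the
    -- segment.
    have hcoord : ∀ a b : ℝ, |a - b| ≤ ((m + 1 : ℕ) : ℝ) * (r / 2) →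
        |a - (a + m / (m + 1) * (b - a))| ≤ m * (r / 2) ∧
          |(a + m / (m + 1) * (b - a)) - b| ≤ r / 2 := by
      intro a b hab
      push_cast at hab
      have e1 : a - (a + m / (m + 1) * (b - a)) = m * ((a - b) / (m + 1)) := by field_simp; ring
      have e2 : (a + m / (m + 1) * (b - a)) - b = (a - b) / (m + 1) := by field_simp; ring
      have e3 : |(a - b) / (m + 1)| ≤ r / 2 := by
        rw [abs_div, abs_of_pos hm, div_le_iff₀ hm]; linarith
      rw [e1, e2, abs_mul, Nat.abs_cast]
      exact ⟨by gcongr, e3⟩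
    obtain ⟨a1, a2⟩ := hcoord _ _ h1
    obtain ⟨b1, b2⟩ := hcoord _ _ h2
    set v : ℂ := ⟨z.re + m / (m + 1) * (w.re - z.re), z.im + m / (m + 1) * (w.im - z.im)⟩
    calc μ (square z r) ≤ (K + 1) ^ m * μ (square v r) := ih z v a1 b1
      _ ≤ (K + 1) ^ m * ((K + 1) * μ (square w r)) := by gcongr; exact step v w a2 b2
      _ = _ := by ring

theorem exists_measure_square_le_ball (h : IsMuckenhoupt μ r P) :
    ∃ K : ℝ≥0∞, K ≠ ∞ ∧ ∀ z : ℂ, μ (square z r) ≤ K * μ (Metric.ball z 1) := by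
  have hr := h.r_pos
  have hρ : 0 < min 1 (r / 2) := by positivity
  obtain ⟨K, hK, hb⟩ := h.exists_measure_square_le
    (ε := volume (Metric.ball (0 : ℂ) (min 1 (r / 2)))) (Metric.measure_ball_pos _ _ hρ).ne'
  refine ⟨K, hK, fun z => (hb z (Metric.ball z (min 1 (r / 2))) ?_ measurableSet_ball ?_).trans ?_⟩
  · intro w hw
    rw [Metric.mem_ball, dist_eq_norm] at hw
    exact mem_square_of_norm_sub_le (hw.le.trans (min_le_right _ _))
  · rw [Complex.volume_ball, Complex.volume_ball]
  · gcongr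
    exact min_le_left _ _

end IsMuckenhoupt

/-! ### Tiles, lattice distance and the weighted sub-mean value inequality -/

/-- The center of the tile of side length `r` with index `n`. -/
noncomputable def tileCenter (r : ℝ) (n : ℤ × ℤ) : ℂ := ⟨r * n.1, r * n.2⟩

/-- The tiles `square (tileCenter r n) r` cover the plane. -/
theorem exists_mem_tile {r : ℝ} (hr : 0 < r) (w : ℂ) :
    ∃ n : ℤ × ℤ, w ∈ square (tileCenter r n) r := by
  have hround : ∀ x : ℝ, |x - r * round (x / r)| ≤ r / 2 := by
    intro x
    have h1 := abs_sub_round (x / r)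
    have h2 : x - r * round (x / r) = r * (x / r - round (x / r)) := by field_simp
    rw [h2, abs_mul, abs_of_pos hr]
    nlinarith
  exact ⟨(round (w.re / r), round (w.im / r)), hround _, hround _⟩

/-- The `ℓ¹`-norm on `ℤ × ℤ`. -/
def latticeNorm (n : ℤ × ℤ) : ℕ := n.1.natAbs + n.2.natAbs

theorem latticeNorm_cast (n : ℤ × ℤ) : (latticeNorm n : ℝ) = |(n.1 : ℝ)| + |(n.2 : ℝ)| := by
  simp [latticeNorm, Nat.cast_natAbs]

theorem latticeNorm_sub_comm (n m : ℤ × ℤ) : latticeNorm (n - m) = latticeNorm (m - n) := by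
  simp only [latticeNorm, Prod.fst_sub, Prod.snd_sub]; omega

theorem latticeNorm_sub_le (n m k : ℤ × ℤ) :
    latticeNorm (n - k) ≤ latticeNorm (n - m) + latticeNorm (m - k) := by
  simp only [latticeNorm, Prod.fst_sub, Prod.snd_sub]; omega

/-- The lattice distance of two tiles is controlled by the distance of their points. -/
theorem latticeNorm_sub_le_norm {r : ℝ} (hr : 0 < r) {n m : ℤ × ℤ} {z w : ℂ} {ρ : ℝ}
    (hz : z ∈ square (tileCenter r n) r) (hw : ‖w - tileCenter r m‖ ≤ ρ) :
    (latticeNorm (n - m) : ℝ) ≤ 2 / r * ‖w - z‖ + (2 / r * ρ + 1) := by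
  have key : ∀ a b x y : ℝ, |x - r * a| ≤ r / 2 → |y - r * b| ≤ ρ → |y - x| ≤ ‖w - z‖ →
      |a - b| ≤ (‖w - z‖ + ρ) / r + 1 / 2 := by
    intro a b x y h1 h2 h3
    have : r * |a - b| ≤ r * ((‖w - z‖ + ρ) / r + 1 / 2) := by
      have e : r * (a - b) = -(x - r * a) - (y - x) + (y - r * b) := by ring
      rw [← abs_of_pos hr, ← abs_mul, abs_of_pos hr, e, mul_add, mul_div_cancel₀ _ hr.ne']
      rw [abs_le] at *
      constructor <;> linarith
    exact le_of_mul_le_mul_left this hr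
  have hre := Complex.abs_re_le_norm (w - z)
  have him := Complex.abs_im_le_norm (w - z)
  have hre' := (Complex.abs_re_le_norm (w - tileCenter r m)).trans hw
  have him' := (Complex.abs_im_le_norm (w - tileCenter r m)).trans hw
  have k1 := key _ _ _ _ hz.1 hre' hre
  have k2 := key _ _ _ _ hz.2 him' him
  rw [latticeNorm_cast]
  push_cast [Prod.fst_sub, Prod.snd_sub]
  calc _ ≤ _ := add_le_add k1 k2
    _ = _ := by ring

namespace IsMuckenhoupt

variable {μ : Measure ℂ} {r P : ℝ}

/-- The masses of tiles grow at most exponentially. -/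
theorem exists_measure_tile_le (h : IsMuckenhoupt μ r P) :
    ∃ K : ℝ≥0∞, K ≠ ∞ ∧ 1 ≤ K ∧ ∀ n m : ℤ × ℤ,
      μ (square (tileCenter r n) r) ≤
        K ^ latticeNorm (n - m) * μ (square (tileCenter r m) r) := by
  have hr := h.r_pos
  obtain ⟨K, hK, hK1, hb⟩ := h.exists_doubling
  -- Doubling moves by half a side, so each unit of lattice distance costs two steps.
  refine ⟨K ^ 2, by simpa using hK, one_le_pow₀ hK1, fun n m => ?_⟩
  rw [← pow_mul]
  have aux : ∀ a b : ℤ, |r * (a : ℝ) - r * b| ≤ r * |((a - b : ℤ) : ℝ)| := by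
    intro a b
    rw [← mul_sub, abs_mul, abs_of_pos hr]; push_cast; exact le_rfl
  apply hb
  all_goals
    refine (aux _ _).trans ?_
    push_cast
    rw [latticeNorm_cast]
    push_cast [Prod.fst_sub, Prod.snd_sub]
    have h1 := abs_nonneg ((n.1 : ℝ) - m.1)
    have h2 := abs_nonneg ((n.2 : ℝ) - m.2)
    nlinarith

/-- A unit disc is covered by a number of squares of side r depending only on r, each comparable in
mass to the central one. -/
theorem exists_measure_ball_le_square (h : IsMuckenhoupt μ r P) :
    ∃ K : ℝ≥0∞, K ≠ ∞ ∧ ∀ z : ℂ, μ (Metric.ball z 1) ≤ K * μ (square z r) := by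
  have hr := h.r_pos
  obtain ⟨K, hK, hK1, hb⟩ := h.exists_doubling
  obtain ⟨m, hm⟩ := exists_nat_ge (1 / r + 1 / 2)
  set I := Finset.Icc (-(m : ℤ)) m ×ˢ Finset.Icc (-(m : ℤ)) m
  refine ⟨I.card * K ^ (2 * m), by finiteness, fun z => ?_⟩
  have hcover : Metric.ball z 1 ⊆ ⋃ n ∈ I, square (z + tileCenter r n) r := by
    intro w hw
    rw [Metric.mem_ball, dist_eq_norm] at hw
    obtain ⟨n, hn⟩ := exists_mem_tile hr (w - z)
    have hbd : ∀ (x : ℝ) (k : ℤ), |x| < 1 → |x - r * k| ≤ r / 2 → -(m : ℤ) ≤ k ∧ k ≤ m := by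
      intro x k hx hk
      have : |(k : ℝ)| ≤ m := by
        refine le_trans ?_ hm
        have e : r * |(k : ℝ)| ≤ r * (1 / r + 1 / 2) := by
          rw [mul_add, mul_one_div_cancel hr.ne', ← abs_of_pos hr, ← abs_mul, abs_of_pos hr]
          rw [abs_le] at *
          rw [abs_lt] at hx
          constructor <;> linarith
        exact le_of_mul_le_mul_left e hr
      rw [abs_le] at this
      exact ⟨by exact_mod_cast this.1, by exact_mod_cast this.2⟩
    simp only [Set.mem_iUnion]
    refine ⟨n, ?_, ?_⟩
    · simp only [I, Finset.mem_product, Finset.mem_Icc]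
      exact ⟨hbd _ _ ((Complex.abs_re_le_norm _).trans_lt hw) hn.1,
        hbd _ _ ((Complex.abs_im_le_norm _).trans_lt hw) hn.2⟩
    · simpa [square, sub_sub] using hn
  calc μ (Metric.ball z 1) ≤ μ (⋃ n ∈ I, square (z + tileCenter r n) r) := measure_mono hcover
    _ ≤ ∑ n ∈ I, μ (square (z + tileCenter r n) r) := measure_biUnion_finset_le _ _
    _ ≤ ∑ n ∈ I, K ^ (2 * m) * μ (square z r) := by
        refine Finset.sum_le_sum fun n hn => ?_
        simp only [I, Finset.mem_product, Finset.mem_Icc] at hn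
        have aux : ∀ k : ℤ, -(m : ℤ) ≤ k ∧ k ≤ m → |r * (k : ℝ)| ≤ ((2 * m : ℕ) : ℝ) * (r / 2) := by
          intro k hk
          have : |(k : ℝ)| ≤ m := abs_le.2 ⟨by exact_mod_cast hk.1, by exact_mod_cast hk.2⟩
          rw [abs_mul, abs_of_pos hr]
          push_cast
          nlinarith
        refine hb _ _ _ ?_ ?_
        · simpa [tileCenter] using aux _ hn.1
        · simpa [tileCenter] using aux _ hn.2
    _ = _ := by rw [Finset.sum_const, nsmul_eq_mul]; ring

/-- The weighted sub-mean value inequality for entire functions. -/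
theorem exists_weightedModulus_rpow_le (h : IsMuckenhoupt μ r P) {s : ℝ} (hs : 0 < s) (γ : ℝ) :
    ∃ C : ℝ≥0∞, C ≠ ∞ ∧ ∀ g : ℂ → ℂ, Differentiable ℂ g → ∀ z : ℂ,
      weightedModulus γ g z ^ s * μ (square z r) ≤
        C * ∫⁻ w in square z r, weightedModulus γ g w ^ s ∂μ := by
  have hr := h.r_pos
  have hP : 0 < P := zero_lt_one.trans_le h.one_le
  -- The area inequality is used with exponent s/P, so that the P-th power in the Muckenhoupt bound
  -- restores s.
  have ht : 0 < s / P := by positivity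
  obtain ⟨C, hC, hb⟩ := h.bound
  obtain ⟨C₁, hC₁, hsub⟩ := enorm_rpow_le_lintegral_ball ht (half_pos hr)
  set E := ENNReal.ofReal (Real.exp (|γ| / 2 * (r / 2) ^ 2)) with hE
  refine ⟨(ENNReal.ofReal C₁ * E ^ (s / P)) ^ P * C, by finiteness, fun g hg z => ?_⟩
  -- The zero-free exponential factor recenters the Gaussian at z: |F(w)| is the weighted modulus of
  -- g times exp(γ|w-z|²/2), with equality of the two at z and bounded distortion nearby. No sign of
  -- γ is needed, whence |γ| in E.
  set F : ℂ → ℂ := fun w => g w *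
    Complex.exp (-γ * (starRingEnd ℂ) z * w + γ * ‖z‖ ^ 2 / 2) with hF
  have hFd : Differentiable ℂ F := by fun_prop
  have hFw : ∀ w, ‖F w‖ₑ = weightedModulus γ g w *
      ENNReal.ofReal (Real.exp (γ / 2 * ‖w - z‖ ^ 2)) := by
    intro w
    rw [← ofReal_norm, weightedModulus, ← ENNReal.ofReal_mul (by positivity), hF]
    congr 1
    rw [norm_mul, Complex.norm_exp, mul_assoc ‖g w‖, ← Real.exp_add]
    congr 2
    rw [← Complex.ofReal_pow, ← Complex.normSq_eq_norm_sq, ← Complex.normSq_eq_norm_sq,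
      ← Complex.normSq_eq_norm_sq]
    simp [Complex.normSq_apply]
    ring
  have hFz : ‖F z‖ₑ = weightedModulus γ g z := by rw [hFw]; simp
  have hpt : ∀ w ∈ Metric.ball z (r / 2),
      ‖F w‖ₑ ^ (s / P) ≤ E ^ (s / P) * weightedModulus γ g w ^ (s / P) := by
    intro w hw
    rw [Metric.mem_ball, dist_eq_norm] at hw
    rw [← ENNReal.mul_rpow_of_nonneg _ _ ht.le, hFw, mul_comm E]
    rw [hE]
    gcongr
    exact le_abs_self γ
  have hball : Metric.ball z (r / 2) ⊆ square z r := fun w hw =>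
    mem_square_of_norm_sub_le (by rw [← dist_eq_norm]; exact (Metric.mem_ball.1 hw).le)
  have hmeas : Measurable (weightedModulus γ g) :=
    (continuous_weightedModulus hg.continuous).measurable
  calc weightedModulus γ g z ^ s * μ (square z r)
      = (‖F z‖ₑ ^ (s / P)) ^ P * μ (square z r) := by
        rw [hFz, ← ENNReal.rpow_mul, div_mul_cancel₀ _ hP.ne']
    _ ≤ (ENNReal.ofReal C₁ * ∫⁻ w in Metric.ball z (r / 2), ‖F w‖ₑ ^ (s / P)) ^ P *
          μ (square z r) := by
        gcongr
        exact hsub F hFd z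
    _ ≤ (ENNReal.ofReal C₁ * (E ^ (s / P) *
          ∫⁻ w in square z r, weightedModulus γ g w ^ (s / P))) ^ P * μ (square z r) := by
        gcongr
        rw [← lintegral_const_mul' _ _ (by finiteness)]
        exact (setLIntegral_mono' measurableSet_ball hpt).trans (lintegral_mono_set hball)
    _ = (ENNReal.ofReal C₁ * E ^ (s / P)) ^ P *
          ((∫⁻ w in square z r, weightedModulus γ g w ^ (s / P)) ^ P * μ (square z r)) := by
        rw [← mul_assoc (ENNReal.ofReal C₁), ENNReal.mul_rpow_of_nonneg _ _ hP.le, mul_assoc]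
    _ ≤ (ENNReal.ofReal C₁ * E ^ (s / P)) ^ P *
          (C * ∫⁻ w in square z r, (weightedModulus γ g w ^ (s / P)) ^ P ∂μ) := by
        exact mul_le_mul_right (hb z _ (hmeas.pow_const (s / P))) _
    _ = _ := by
        simp_rw [← ENNReal.rpow_mul, div_mul_cancel₀ _ hP.ne', mul_assoc]

end IsMuckenhoupt

/-! ### Sequences on the lattice: majorants and uniform boundedness -/

theorem summable_pow_latticeNorm {ρ : ℝ} (h0 : 0 ≤ ρ) (h1 : ρ < 1) :
    Summable fun n : ℤ × ℤ => ρ ^ latticeNorm n := by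
  have hg := summable_geometric_of_lt_one h0 h1
  have hZ : Summable fun k : ℤ => ρ ^ k.natAbs :=
    Summable.of_nat_of_neg (by simpa using hg) (by simpa using hg)
  simpa only [latticeNorm, pow_add] using
    hZ.mul_of_nonneg hZ (fun k => pow_nonneg h0 _) (fun k => pow_nonneg h0 _)

theorem tsum_pow_latticeNorm_ne_top : ∑' n : ℤ × ℤ, (2⁻¹ : ℝ≥0∞) ^ latticeNorm n ≠ ∞ := by
  have h := (summable_pow_latticeNorm (ρ := 2⁻¹) (by norm_num) (by norm_num)).tsum_ofReal_ne_top
  convert h using 3 with n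
  rw [ENNReal.ofReal_pow (by norm_num), ENNReal.ofReal_inv_of_pos (by norm_num)]
  simp

open scoped NNReal in
/-- A sequence which is summable against an exponentially varying weight has a slowly varying
majorant which is still summable. -/
theorem exists_slowly_varying_majorant {w : ℤ × ℤ → ℝ≥0∞} {K : ℝ≥0} (hK : 1 ≤ K)
    (hw : ∀ n m, w n ≤ K ^ latticeNorm (n - m) * w m) :
    ∃ L : ℝ≥0, 1 ≤ L ∧ ∀ x : ℤ × ℤ → ℝ≥0∞, ∑' n, x n * w n ≠ ∞ →
      ∃ y : ℤ × ℤ → ℝ≥0∞, (∀ n, x n ≤ y n) ∧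
        (∀ n m, y n ≤ L ^ latticeNorm (n - m) * y m) ∧ ∑' n, y n * w n ≠ ∞ := by
  have hL1 : 1 ≤ 2 * K := by
    calc (1 : ℝ≥0) ≤ K := hK
      _ ≤ 2 * K := le_mul_of_one_le_left zero_le (by norm_num)
  -- With L = 2K, the growth K of w is absorbed and a geometric series of ratio 1/2 is left.
  set L : ℝ≥0 := 2 * K with hL
  have hL0 : L ≠ 0 := (zero_lt_one.trans_le hL1).ne'
  refine ⟨L, hL1, fun x hx => ?_⟩
  have hLi : ((L : ℝ≥0∞))⁻¹ ≤ 1 := by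
    rw [ENNReal.inv_le_one]; exact_mod_cast hL1
  have hLL : (L : ℝ≥0∞) * (L : ℝ≥0∞)⁻¹ = 1 :=
    ENNReal.mul_inv_cancel (by exact_mod_cast hL0) ENNReal.coe_ne_top
  -- The majorant is the convolution of x with L^(-|n|); the triangle inequality for the lattice
  -- norm makes it vary slowly.
  refine ⟨fun n => ∑' m, x m * (L : ℝ≥0∞)⁻¹ ^ latticeNorm (n - m), fun n => ?_, fun n m => ?_, ?_⟩
  · refine le_trans ?_ (ENNReal.le_tsum n)
    simp [latticeNorm]
  · rw [← ENNReal.tsum_mul_left]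
    refine ENNReal.tsum_le_tsum fun k => ?_
    calc x k * (L : ℝ≥0∞)⁻¹ ^ latticeNorm (n - k)
        = x k * ((L : ℝ≥0∞) ^ latticeNorm (n - m) *
            ((L : ℝ≥0∞)⁻¹ ^ (latticeNorm (m - n) + latticeNorm (n - k)))) := by
          rw [latticeNorm_sub_comm m n, pow_add, ← mul_assoc (_ ^ _), ← mul_pow, hLL, one_pow,
            one_mul]
      _ ≤ x k * ((L : ℝ≥0∞) ^ latticeNorm (n - m) * (L : ℝ≥0∞)⁻¹ ^ latticeNorm (m - k)) := by
          gcongr _ * (_ * ?_)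
          exact pow_le_pow_of_le_one zero_le hLi (latticeNorm_sub_le _ _ _)
      _ = _ := by ring
  · have hKL : (L : ℝ≥0∞)⁻¹ * K = 2⁻¹ := by
      have hK0 : K ≠ 0 := (zero_lt_one.trans_le hK).ne'
      rw [← ENNReal.coe_inv hL0, ← ENNReal.coe_mul, hL, mul_inv, mul_assoc,
        inv_mul_cancel₀ hK0, mul_one]
      simp
    refine ne_top_of_le_ne_top (ENNReal.mul_ne_top hx tsum_pow_latticeNorm_ne_top) ?_
    calc ∑' n, (∑' m, x m * (L : ℝ≥0∞)⁻¹ ^ latticeNorm (n - m)) * w n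
        = ∑' m, ∑' n, x m * (L : ℝ≥0∞)⁻¹ ^ latticeNorm (n - m) * w n := by
          rw [ENNReal.tsum_comm]
          simp_rw [ENNReal.tsum_mul_right]
      _ ≤ ∑' m, ∑' n, x m * w m * 2⁻¹ ^ latticeNorm (n - m) := by
          refine ENNReal.tsum_le_tsum fun m => ENNReal.tsum_le_tsum fun n => ?_
          calc x m * (L : ℝ≥0∞)⁻¹ ^ latticeNorm (n - m) * w n
              ≤ x m * (L : ℝ≥0∞)⁻¹ ^ latticeNorm (n - m) *
                  (K ^ latticeNorm (n - m) * w m) := by gcongr; exact hw n m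
            _ = x m * w m * ((L : ℝ≥0∞)⁻¹ * K) ^ latticeNorm (n - m) := by
                rw [mul_pow]; ring
            _ = _ := by rw [hKL]
      _ = ∑' m, x m * w m * ∑' n, 2⁻¹ ^ latticeNorm n := by
          refine tsum_congr fun m => ?_
          rw [ENNReal.tsum_mul_left]
          congr 1
          exact (Equiv.subRight m).tsum_eq fun n => (2⁻¹ : ℝ≥0∞) ^ latticeNorm n
      _ = _ := ENNReal.tsum_mul_right

/-- A uniform boundedness principle for positive sequences. -/
theorem exists_bound_of_tsum_ne_top {ι : Type*} {w b : ι → ℝ≥0∞} {θ : ℝ} (hθ : 0 < θ)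
    (h : ∀ x : ι → ℝ≥0∞, ∑' n, x n * w n ≠ ∞ → ∑' n, x n ^ θ * b n ≠ ∞) :
    ∃ C : ℝ≥0∞, C ≠ ∞ ∧ ∀ x : ι → ℝ≥0∞, ∑' n, x n * w n ≤ 1 → ∑' n, x n ^ θ * b n ≤ C := by
  by_contra! hcon
  -- If no bound exists, sequences x_k in the unit ball exceed these thresholds, and Σ 2^(-k) x_k
  -- violates the hypothesis; (2^k)^θ compensates the weight 2^(-k).
  have hD : ∀ k : ℕ, (k : ℝ≥0∞) * (2 ^ k) ^ θ ≠ ∞ := fun k => by finiteness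
  choose x hx hxb using fun k : ℕ => hcon _ (hD k)
  refine h (fun n => ∑' k, 2⁻¹ ^ k * x k n) ?_ ?_
  · have : ∑' n, (∑' k, 2⁻¹ ^ k * x k n) * w n ≤ ∑' k : ℕ, (2⁻¹ : ℝ≥0∞) ^ k := by
      calc _ = ∑' k, 2⁻¹ ^ k * ∑' n, x k n * w n := by
            simp_rw [← ENNReal.tsum_mul_left, ← ENNReal.tsum_mul_right, ← mul_assoc]
            rw [ENNReal.tsum_comm]
        _ ≤ ∑' k, 2⁻¹ ^ k * 1 := by gcongr with k; exact hx k
        _ = _ := by simp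
    refine ne_top_of_le_ne_top ?_ this
    rw [ENNReal.tsum_geometric, ENNReal.one_sub_inv_two, inv_inv]
    exact ENNReal.ofNat_ne_top
  · refine ENNReal.eq_top_of_forall_nnreal_le fun a => ?_
    obtain ⟨k, hk⟩ := exists_nat_ge a
    calc (a : ℝ≥0∞) ≤ k := by exact_mod_cast hk
      _ = (2⁻¹ ^ k) ^ θ * (k * (2 ^ k) ^ θ) := by
          rw [mul_left_comm, ← ENNReal.mul_rpow_of_nonneg _ _ hθ.le, ← mul_pow,
            ENNReal.inv_mul_cancel two_ne_zero ENNReal.ofNat_ne_top]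
          simp
      _ ≤ (2⁻¹ ^ k) ^ θ * ∑' n, x k n ^ θ * b n := by gcongr; exact (hxb k).le
      _ = ∑' n, (2⁻¹ ^ k * x k n) ^ θ * b n := by
          rw [← ENNReal.tsum_mul_left]
          refine tsum_congr fun n => ?_
          rw [ENNReal.mul_rpow_of_nonneg _ _ hθ.le, mul_assoc]
      _ ≤ _ := by
          gcongr with n
          exact ENNReal.le_tsum (f := fun k => 2⁻¹ ^ k * x k n) k

/-! ### Gaussian decay and sums of reproducing kernels -/

theorem exp_neg_latticeNorm (n : ℤ × ℤ) :
    Real.exp (-(latticeNorm n : ℝ)) = Real.exp (-1) ^ latticeNorm n := by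
  rw [← Real.exp_nat_mul]; ring_nf

theorem summable_exp_neg_latticeNorm :
    Summable fun n : ℤ × ℤ => Real.exp (-(latticeNorm n : ℝ)) := by
  simp_rw [exp_neg_latticeNorm]
  exact summable_pow_latticeNorm (Real.exp_pos _).le (by simp)

theorem summable_exp_neg_latticeNorm_sub (m : ℤ × ℤ) :
    Summable fun n : ℤ × ℤ => Real.exp (-(latticeNorm (n - m) : ℝ)) :=
  (Equiv.subRight m).summable_iff.2 summable_exp_neg_latticeNorm

theorem tsum_exp_neg_latticeNorm_sub (m : ℤ × ℤ) :
    ∑' n : ℤ × ℤ, Real.exp (-(latticeNorm (n - m) : ℝ)) =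
      ∑' n : ℤ × ℤ, Real.exp (-(latticeNorm n : ℝ)) :=
  (Equiv.subRight m).tsum_eq fun n : ℤ × ℤ => Real.exp (-(latticeNorm n : ℝ))

/-- Gaussians centered at the points of the tiles decay faster than any exponential. -/
theorem exists_gaussian_le {α r : ℝ} (hα : 0 < α) (hr : 0 < r) {A : ℝ} (hA : 0 ≤ A) (ρ : ℝ) :
    ∃ K : ℝ, 0 < K ∧ ∀ (n m : ℤ × ℤ) (z w : ℂ), z ∈ square (tileCenter r n) r →
      ‖w - tileCenter r m‖ ≤ ρ →
      Real.exp (-(α / 2 * ‖w - z‖ ^ 2)) ≤ K * Real.exp (-(A * latticeNorm (n - m))) := by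
  refine ⟨Real.exp (A * (2 / r * ρ + 1) + (A * (2 / r)) ^ 2 / (2 * α)), Real.exp_pos _,
    fun n m z w hz hw => ?_⟩
  rw [← Real.exp_add, Real.exp_le_exp]
  have h1 := mul_le_mul_of_nonneg_left (latticeNorm_sub_le_norm hr hz hw) hA
  have h2 : A * (2 / r) * ‖w - z‖ ≤ α / 2 * ‖w - z‖ ^ 2 + (A * (2 / r)) ^ 2 / (2 * α) := by
    have e : α / 2 * ‖w - z‖ ^ 2 + (A * (2 / r)) ^ 2 / (2 * α) - A * (2 / r) * ‖w - z‖
        = (α * ‖w - z‖ - A * (2 / r)) ^ 2 / (2 * α) := by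
      field_simp; ring
    have : 0 ≤ (α * ‖w - z‖ - A * (2 / r)) ^ 2 / (2 * α) := by positivity
    linarith
  linarith

/-- A Gaussian decays at the exponential rate log l + 2: the part log l absorbs the variation of c.
Of the two remaining decaying factors, one makes sums converge and the other becomes small on
separated indices. -/
theorem exists_slow_mul_gaussian_le {α r : ℝ} (hα : 0 < α) (hr : 0 < r) {l : ℝ} (hl : 1 ≤ l)
    (ρ : ℝ) :
    ∃ K : ℝ, 0 < K ∧ ∀ c : ℤ × ℤ → ℝ, (∀ n, 0 ≤ c n) →
      (∀ n m, c n ≤ l ^ latticeNorm (n - m) * c m) → ∀ (n m : ℤ × ℤ) (z w : ℂ),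
      z ∈ square (tileCenter r n) r → ‖w - tileCenter r m‖ ≤ ρ →
      c n * Real.exp (-(α / 2 * ‖w - z‖ ^ 2)) ≤
        K * c m * Real.exp (-(latticeNorm (n - m) : ℝ)) *
          Real.exp (-(latticeNorm (n - m) : ℝ)) := by
  have hlog : 0 ≤ Real.log l := Real.log_nonneg hl
  obtain ⟨K, hK, h⟩ := exists_gaussian_le hα hr (A := Real.log l + 2) (by positivity) ρ
  refine ⟨K, hK, fun c hc hslow n m z w hz hw => ?_⟩
  have hpow : l ^ latticeNorm (n - m) * Real.exp (-((Real.log l + 2) * latticeNorm (n - m)))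
      = Real.exp (-(latticeNorm (n - m) : ℝ)) * Real.exp (-(latticeNorm (n - m) : ℝ)) := by
    conv_lhs => rw [← Real.exp_log (zero_lt_one.trans_le hl)]
    rw [Real.log_exp, ← Real.exp_nat_mul, ← Real.exp_add, ← Real.exp_add]
    ring_nf
  calc c n * Real.exp (-(α / 2 * ‖w - z‖ ^ 2))
      ≤ (l ^ latticeNorm (n - m) * c m) *
          (K * Real.exp (-((Real.log l + 2) * latticeNorm (n - m)))) :=
        mul_le_mul (hslow n m) (h n m z w hz hw) (Real.exp_pos _).le
          (mul_nonneg (by positivity) (hc m))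
    _ = K * c m *
          (l ^ latticeNorm (n - m) * Real.exp (-((Real.log l + 2) * latticeNorm (n - m)))) := by
        ring
    _ = _ := by rw [hpow]; ring

/-- The normalized reproducing kernel of the Fock space at `z`. -/
noncomputable def fockKernel (α : ℝ) (z w : ℂ) : ℂ :=
  Complex.exp (α * (starRingEnd ℂ) z * w - α * ‖z‖ ^ 2 / 2)

theorem norm_fockKernel_mul_exp (α : ℝ) (z w : ℂ) :
    ‖fockKernel α z w‖ * Real.exp (-(α / 2 * ‖w‖ ^ 2)) =
      Real.exp (-(α / 2 * ‖w - z‖ ^ 2)) := by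
  rw [fockKernel, Complex.norm_exp, ← Real.exp_add]
  congr 1
  rw [← Complex.ofReal_pow, ← Complex.normSq_eq_norm_sq, ← Complex.normSq_eq_norm_sq,
    ← Complex.normSq_eq_norm_sq]
  simp [Complex.normSq_apply]
  ring

/-- Sums of normalized kernels with slowly varying coefficients over a separated set of tiles:
they have the size of the coefficients near the chosen points, and are never larger. -/
theorem exists_fock_interpolant {α r : ℝ} (hα : 0 < α) (hr : 0 < r) {l : ℝ} (hl : 1 ≤ l) :
    ∃ N : ℕ, ∃ κ B : ℝ, 8 ≤ N ∧ 0 < κ ∧ ∀ c : ℤ × ℤ → ℝ, (∀ n, 0 ≤ c n) →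
      (∀ n m, c n ≤ l ^ latticeNorm (n - m) * c m) →
      ∀ z : ℤ × ℤ → ℂ, (∀ n, z n ∈ square (tileCenter r n) r) →
      ∀ S : Set (ℤ × ℤ), (∀ n ∈ S, ∀ m ∈ S, n ≠ m → N ≤ latticeNorm (n - m)) →
      ∃ f : ℂ → ℂ, Differentiable ℂ f ∧
        (∀ m, ∀ w ∈ square (tileCenter r m) r,
          ‖f w‖ * Real.exp (-(α / 2 * ‖w‖ ^ 2)) ≤ B * c m) ∧
        ∀ m ∈ S, ∀ w ∈ square (z m) r, κ * c m ≤ ‖f w‖ * Real.exp (-(α / 2 * ‖w‖ ^ 2)) := by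
  -- Radius 2r about the tile center also covers the square of side r around any point of the tile.
  obtain ⟨K, hK, hKb⟩ := exists_slow_mul_gaussian_le hα hr hl (2 * r)
  set T : ℝ := ∑' n : ℤ × ℤ, Real.exp (-(latticeNorm n : ℝ)) with hT
  have hT0 : 0 < T := summable_exp_neg_latticeNorm.tsum_pos (fun n => (Real.exp_pos _).le) 0
    (Real.exp_pos _)
  -- Chosen so that the off-diagonal terms total at most half of the least value of the diagonal
  -- term.
  set ε : ℝ := Real.exp (-(α / 2 * r ^ 2)) / (2 * K * T) with hε
  have hε0 : 0 < ε := by positivity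
  obtain ⟨N₀, hN₀⟩ := exists_nat_ge (-Real.log ε)
  -- The extra 8 in the separation serves to make the squares around the chosen points disjoint.
  refine ⟨N₀ + 8, Real.exp (-(α / 2 * r ^ 2)) / 2, K * T, by omega, by positivity,
    fun c hc hslow z hz S hS => ?_⟩
  have hNε : Real.exp (-((N₀ + 8 : ℕ) : ℝ)) ≤ ε := by
    rw [← Real.le_log_iff_exp_le hε0]
    push_cast
    linarith
  have hterm : ∀ n w, ‖(c n : ℂ) * fockKernel α (z n) w‖ * Real.exp (-(α / 2 * ‖w‖ ^ 2)) =
      c n * Real.exp (-(α / 2 * ‖w - z n‖ ^ 2)) := by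
    intro n w
    rw [norm_mul, mul_assoc, norm_fockKernel_mul_exp, Complex.norm_real, Real.norm_of_nonneg (hc n)]
  have hsmall : ∀ k : ℕ, Real.exp (-(k : ℝ)) ≤ 1 := fun k => by simp
  have hterm_le : ∀ m w, ‖w - tileCenter r m‖ ≤ 2 * r → ∀ n,
      ‖(c n : ℂ) * fockKernel α (z n) w‖ * Real.exp (-(α / 2 * ‖w‖ ^ 2)) ≤
        K * c m * Real.exp (-(latticeNorm (n - m) : ℝ)) * Real.exp (-(latticeNorm (n - m) : ℝ)) :=
    fun m w hw n => (hterm n w).trans_le (hKb c hc hslow n m (z n) w (hz n) hw)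
  have hterm_le' : ∀ m w, ‖w - tileCenter r m‖ ≤ 2 * r → ∀ n,
      ‖(c n : ℂ) * fockKernel α (z n) w‖ * Real.exp (-(α / 2 * ‖w‖ ^ 2)) ≤
        K * c m * Real.exp (-(latticeNorm (n - m) : ℝ)) := by
    intro m w hw n
    refine (hterm_le m w hw n).trans (mul_le_of_le_one_right ?_ (hsmall _))
    exact mul_nonneg (mul_nonneg hK.le (hc m)) (Real.exp_pos _).le
  have hsum : ∀ w, Summable fun n =>
      ‖(c n : ℂ) * fockKernel α (z n) w‖ * Real.exp (-(α / 2 * ‖w‖ ^ 2)) := by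
    intro w
    obtain ⟨m, hm⟩ := exists_mem_tile hr w
    refine Summable.of_nonneg_of_le (fun n => by positivity)
      (hterm_le' m w ((norm_sub_le_of_mem_square hm).trans (by linarith)))
      ((summable_exp_neg_latticeNorm_sub m).mul_left _)
  have hsum' : ∀ w, Summable fun n : S => ‖(c n : ℂ) * fockKernel α (z n) w‖ := by
    intro w
    have := (hsum w).mul_right (Real.exp (-(α / 2 * ‖w‖ ^ 2)))⁻¹
    simp only [mul_inv_cancel_right₀ (Real.exp_ne_zero _)] at this
    exact this.subtype S
  refine ⟨fun w => ∑' n : S, (c n : ℂ) * fockKernel α (z n) w, ?_, ?_, ?_⟩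
  · intro w₀
    -- Comparing all terms with the tile at the origin gives a summable majorant on a disc
    -- containing w₀, hence holomorphy of the sum.
    obtain ⟨K', hK', hKb'⟩ := exists_slow_mul_gaussian_le hα hr hl (‖w₀‖ + 1)
    have hmem : Metric.ball (0 : ℂ) (‖w₀‖ + 1) ∈ nhds w₀ := Metric.isOpen_ball.mem_nhds (by simp)
    refine (Complex.differentiableOn_tsum_of_summable_norm (u := fun n : S =>
      K' * c 0 * Real.exp (-(latticeNorm (n - 0 : ℤ × ℤ) : ℝ)) *
        Real.exp (α / 2 * (‖w₀‖ + 1) ^ 2)) ?_ ?_ Metric.isOpen_ball ?_).differentiableAt hmem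
    · exact (((summable_exp_neg_latticeNorm_sub 0).mul_left _).mul_right _).subtype S
    · intro n
      unfold fockKernel
      fun_prop
    · intro n w hw
      rw [mem_ball_zero_iff] at hw
      have h1 := hKb' c hc hslow n 0 (z n) w (hz n) (by
        have : tileCenter r 0 = 0 := by apply Complex.ext <;> simp [tileCenter]
        rw [this, sub_zero]; exact hw.le)
      have h2 : K' * c 0 * Real.exp (-(latticeNorm (n - 0 : ℤ × ℤ) : ℝ)) *
          Real.exp (-(latticeNorm (n - 0 : ℤ × ℤ) : ℝ)) ≤
          K' * c 0 * Real.exp (-(latticeNorm (n - 0 : ℤ × ℤ) : ℝ)) :=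
        mul_le_of_le_one_right (mul_nonneg (mul_nonneg hK'.le (hc 0)) (Real.exp_pos _).le)
          (hsmall _)
      have h3 := (hterm n w).le.trans (h1.trans h2)
      calc ‖(c n : ℂ) * fockKernel α (z n) w‖
          = ‖(c n : ℂ) * fockKernel α (z n) w‖ * Real.exp (-(α / 2 * ‖w‖ ^ 2)) *
              Real.exp (α / 2 * ‖w‖ ^ 2) := by
            rw [mul_assoc, ← Real.exp_add]; simp
        _ ≤ _ := by
            apply mul_le_mul h3 _ (Real.exp_pos _).le
            · exact mul_nonneg (mul_nonneg hK'.le (hc 0)) (Real.exp_pos _).le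
            · rw [Real.exp_le_exp]; gcongr
  · intro m w hw
    have hw' : ‖w - tileCenter r m‖ ≤ 2 * r :=
      (norm_sub_le_of_mem_square hw).trans (by linarith)
    calc ‖∑' n : S, (c n : ℂ) * fockKernel α (z n) w‖ * Real.exp (-(α / 2 * ‖w‖ ^ 2))
        ≤ (∑' n : S, ‖(c n : ℂ) * fockKernel α (z n) w‖) * Real.exp (-(α / 2 * ‖w‖ ^ 2)) := by
          gcongr
          exact norm_tsum_le_tsum_norm (hsum' w)
      _ = ∑' n : S, ‖(c n : ℂ) * fockKernel α (z n) w‖ * Real.exp (-(α / 2 * ‖w‖ ^ 2)) :=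
          tsum_mul_right.symm
      _ ≤ ∑' n, ‖(c n : ℂ) * fockKernel α (z n) w‖ * Real.exp (-(α / 2 * ‖w‖ ^ 2)) :=
          (hsum w).tsum_subtype_le _ S (fun n => by positivity)
      _ ≤ ∑' n, K * c m * Real.exp (-(latticeNorm (n - m) : ℝ)) :=
          (hsum w).tsum_le_tsum (hterm_le' m w hw') ((summable_exp_neg_latticeNorm_sub m).mul_left _)
      _ = K * T * c m := by rw [tsum_mul_left, tsum_exp_neg_latticeNorm_sub]; ring
  · intro m hm w hw
    have hw' : ‖w - tileCenter r m‖ ≤ 2 * r := by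
      have h1 := norm_sub_le_of_mem_square hw
      have h2 := norm_sub_le_of_mem_square (hz m)
      have := norm_sub_le_norm_sub_add_norm_sub w (z m) (tileCenter r m)
      linarith
    set t : S → ℂ := fun n => (c n : ℂ) * fockKernel α (z n) w with ht
    set e : ℝ := Real.exp (-(α / 2 * ‖w‖ ^ 2)) with he
    have he0 : 0 < e := Real.exp_pos _
    classical
    have hsplit := (hsum' w).of_norm.tsum_eq_add_tsum_ite ⟨m, hm⟩
    have hite : Summable fun n : S => ‖if n = ⟨m, hm⟩ then 0 else t n‖ := by
      refine Summable.of_nonneg_of_le (fun n => norm_nonneg _) (fun n => ?_) (hsum' w)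
      split_ifs
      · rw [norm_zero]; exact norm_nonneg _
      · exact le_rfl
    have hoff : ‖∑' n : S, if n = ⟨m, hm⟩ then 0 else t n‖ * e ≤ K * c m * ε * T := by
      have hle : ∀ n : S, ‖if n = ⟨m, hm⟩ then 0 else t n‖ * e ≤
          K * c m * ε * Real.exp (-(latticeNorm (n - m : ℤ × ℤ) : ℝ)) := by
        intro n
        have hcm := hc m
        split_ifs with hnm
        · simp only [norm_zero, zero_mul]; positivity
        · refine (hterm_le m w hw' n).trans ?_
          have hN : N₀ + 8 ≤ latticeNorm (n - m : ℤ × ℤ) :=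
            hS n n.2 m hm fun h => hnm (Subtype.ext h)
          gcongr
          refine le_trans ?_ hNε
          rw [Real.exp_le_exp, neg_le_neg_iff]
          exact_mod_cast hN
      have hs1 := (summable_exp_neg_latticeNorm_sub m).mul_left (K * c m * ε)
      calc ‖∑' n : S, if n = ⟨m, hm⟩ then 0 else t n‖ * e
          ≤ (∑' n : S, ‖if n = ⟨m, hm⟩ then 0 else t n‖) * e := by
            gcongr
            exact norm_tsum_le_tsum_norm hite
        _ = ∑' n : S, ‖if n = ⟨m, hm⟩ then 0 else t n‖ * e := tsum_mul_right.symm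
        _ ≤ ∑' n : S, K * c m * ε * Real.exp (-(latticeNorm (n - m : ℤ × ℤ) : ℝ)) :=
            (hite.mul_right e).tsum_le_tsum hle (hs1.subtype S)
        _ ≤ ∑' n, K * c m * ε * Real.exp (-(latticeNorm (n - m) : ℝ)) :=
            hs1.tsum_subtype_le _ S (fun n => by have := hc m; positivity)
        _ = K * c m * ε * T := by rw [tsum_mul_left, tsum_exp_neg_latticeNorm_sub]
    have hmain : c m * Real.exp (-(α / 2 * r ^ 2)) ≤ ‖t ⟨m, hm⟩‖ * e := by
      rw [ht, he, hterm]
      have hwz := norm_sub_le_of_mem_square hw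
      gcongr
      exact hc m
    have hεT : K * c m * ε * T = c m * Real.exp (-(α / 2 * r ^ 2)) / 2 := by
      rw [hε]; field_simp
    have htri : ‖t ⟨m, hm⟩‖ ≤ ‖∑' n : S, t n‖ + ‖∑' n : S, if n = ⟨m, hm⟩ then 0 else t n‖ := by
      have : t ⟨m, hm⟩ = (∑' n : S, t n) - ∑' n : S, if n = ⟨m, hm⟩ then 0 else t n := by
        rw [hsplit]; simp [ht]
      conv_lhs => rw [this]
      exact norm_sub_le _ _
    have := mul_le_mul_of_nonneg_right htri he0.le
    rw [add_mul] at this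
    linarith

/-! ### Separated families of tiles and the necessary condition -/

/-- The tiles whose index lies in a given residue class modulo `N`. -/
def residueClass (N : ℕ) (j : ZMod N × ZMod N) : Set (ℤ × ℤ) :=
  {n | ((n.1 : ZMod N), (n.2 : ZMod N)) = j}

theorem le_latticeNorm_of_mem_residueClass {N : ℕ} {j : ZMod N × ZMod N} {n m : ℤ × ℤ}
    (hn : n ∈ residueClass N j) (hm : m ∈ residueClass N j) (hne : n ≠ m) :
    N ≤ latticeNorm (n - m) := by
  have h : ((n.1 : ZMod N), (n.2 : ZMod N)) = ((m.1 : ZMod N), (m.2 : ZMod N)) :=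
    Eq.trans hn (Eq.symm hm)
  rw [Prod.mk.injEq] at h
  have aux : ∀ a b : ℤ, ((a : ZMod N)) = b → a ≠ b → N ≤ (a - b).natAbs := by
    intro a b hab hne
    have hd := (ZMod.intCast_eq_intCast_iff_dvd_sub b a N).1 hab.symm
    exact Nat.le_of_dvd (Int.natAbs_pos.2 (sub_ne_zero.2 hne)) (Int.natCast_dvd.1 hd)
  simp only [latticeNorm, Prod.fst_sub, Prod.snd_sub]
  by_cases h1 : n.1 = m.1
  · have h2 : n.2 ≠ m.2 := fun h2 => hne (Prod.ext h1 h2)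
    have := aux _ _ h.2 h2
    omega
  · have := aux _ _ h.1 h1
    omega

theorem tsum_ne_top_of_residueClass {N : ℕ} [NeZero N] {t : ℤ × ℤ → ℝ≥0∞}
    (h : ∀ j, ∑' n : residueClass N j, t n ≠ ∞) : ∑' n, t n ≠ ∞ := by
  have hU : ⋃ j, residueClass N j = Set.univ := by
    ext n; simp [residueClass]
  have hle := ENNReal.tsum_iUnion_le t (residueClass N)
  rw [hU, tsum_univ] at hle
  exact ne_top_of_le_ne_top (ENNReal.sum_ne_top.2 fun j _ => h j) hle

theorem lintegral_le_tsum_tile {r : ℝ} (hr : 0 < r) (μ : Measure ℂ) (F : ℂ → ℝ≥0∞) :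
    ∫⁻ w, F w ∂μ ≤ ∑' n, ∫⁻ w in square (tileCenter r n) r, F w ∂μ := by
  have hU : ⋃ n, square (tileCenter r n) r = Set.univ := by
    ext w; simpa using exists_mem_tile hr w
  calc ∫⁻ w, F w ∂μ = ∫⁻ w in ⋃ n, square (tileCenter r n) r, F w ∂μ := by
        rw [hU, setLIntegral_univ]
    _ ≤ _ := lintegral_iUnion_le _ _

/-- A common point would force lattice distance at most 2 + 4 + 1 = 7. -/
theorem disjoint_square_of_separated {r : ℝ} (hr : 0 < r) {z : ℤ × ℤ → ℂ}
    (hz : ∀ n, z n ∈ square (tileCenter r n) r) {n m : ℤ × ℤ} (h : 8 ≤ latticeNorm (n - m)) :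
    Disjoint (square (z n) r) (square (z m) r) := by
  rw [Set.disjoint_left]
  intro w hn hm
  have h1 := norm_sub_le_of_mem_square hn
  have h2 := norm_sub_le_of_mem_square hm
  have h3 := norm_sub_le_of_mem_square (hz m)
  have h4 := norm_sub_le_norm_sub_add_norm_sub w (z m) (tileCenter r m)
  have h5 := latticeNorm_sub_le_norm hr (hz n) (h4.trans (add_le_add h2 h3))
  have h6 : 2 / r * ‖w - z n‖ ≤ 2 / r * r := by gcongr
  have h7 : 2 / r * r = 2 := by field_simp
  have h8 : (8 : ℝ) ≤ latticeNorm (n - m) := by exact_mod_cast h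
  linarith

theorem ofReal_mul_le_weightedModulus {α a : ℝ} {f : ℂ → ℂ} {w : ℂ}
    (h : a ≤ ‖f w‖ * Real.exp (-(α / 2 * ‖w‖ ^ 2))) :
    ENNReal.ofReal a ≤ weightedModulus α f w :=
  ENNReal.ofReal_le_ofReal h

/-- The necessary condition satisfied by a multiplier, in terms of its values at points of
the tiles. -/
theorem IsMuckenhoupt.tsum_ne_top_of_multiplier {μ : Measure ℂ} {r P : ℝ}
    (h : IsMuckenhoupt μ r P) {α β p q : ℝ} (hα : 0 < α) (hp : 0 < p) (hq : 0 < q) {g : ℂ → ℂ}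
    (hg : Differentiable ℂ g)
    (hmul : ∀ f : ℂ → ℂ, Differentiable ℂ f → ∫⁻ w, weightedModulus α f w ^ p ∂μ ≠ ∞ →
      ∫⁻ w, weightedModulus β (fun w => g w * f w) w ^ q ∂μ ≠ ∞)
    {z : ℤ × ℤ → ℂ} (hz : ∀ n, z n ∈ square (tileCenter r n) r) (x : ℤ × ℤ → ℝ≥0∞)
    (hx : ∑' n, x n * μ (square (tileCenter r n) r) ≠ ∞) :
    ∑' n, x n ^ (q / p) *
      (weightedModulus (β - α) g (z n) ^ q * μ (square (tileCenter r n) r)) ≠ ∞ := by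
  have hr := h.r_pos
  obtain ⟨K, hKt, hK1, hK⟩ := h.exists_measure_tile_le
  lift K to NNReal using hKt
  obtain ⟨L, hL1, hmaj⟩ := exists_slowly_varying_majorant (by exact_mod_cast hK1) hK
  obtain ⟨y, hxy, hy, hyfin⟩ := hmaj x hx
  have hytop : ∀ n, y n ≠ ∞ := by
    intro n hn
    refine hyfin (ENNReal.tsum_eq_top_of_eq_top ⟨n, ?_⟩)
    rw [hn, ENNReal.top_mul (h.ne_zero _)]
  obtain ⟨C₂, hC₂, hsub⟩ := h.exists_weightedModulus_rpow_le hq (β - α)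
  obtain ⟨K₁, hK₁, -, hdoub⟩ := h.exists_doubling
  -- With these coefficients the p-th power integral of the test function is controlled by Σ y_n
  -- μ(Q_n).
  set c : ℤ × ℤ → ℝ := fun n => (y n).toReal ^ (1 / p) with hc
  have hc0 : ∀ n, 0 ≤ c n := fun n => by positivity
  have hcy : ∀ n (s : ℝ), 0 < s → ENNReal.ofReal (c n) ^ s = y n ^ (s / p) := by
    intro n s hs
    rw [hc, ← ENNReal.ofReal_rpow_of_nonneg ENNReal.toReal_nonneg (by positivity),
      ENNReal.ofReal_toReal (hytop n), ← ENNReal.rpow_mul]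
    ring_nf
  have hslow : ∀ n m, c n ≤ ((L : ℝ) ^ (1 / p)) ^ latticeNorm (n - m) * c m := by
    intro n m
    have h1 : (y n).toReal ≤ (L : ℝ) ^ latticeNorm (n - m) * (y m).toReal := by
      have := ENNReal.toReal_mono (ENNReal.mul_ne_top (by finiteness) (hytop m)) (hy n m)
      simpa using this
    have h2 := Real.rpow_le_rpow ENNReal.toReal_nonneg h1 (by positivity : 0 ≤ 1 / p)
    rw [Real.mul_rpow (by positivity) (by positivity), ← Real.rpow_natCast,
      ← Real.rpow_mul (by positivity), mul_comm ((latticeNorm (n - m) : ℕ) : ℝ),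
      Real.rpow_mul (by positivity), Real.rpow_natCast] at h2
    exact h2
  obtain ⟨N, κ, B, hN, hκ, hint⟩ := exists_fock_interpolant hα hr
    (l := (L : ℝ) ^ (1 / p)) (Real.one_le_rpow (by exact_mod_cast hL1) (by positivity))
  have : NeZero N := ⟨by omega⟩
  -- There are finitely many residue classes, and each gets its own test function.
  refine tsum_ne_top_of_residueClass (N := N) fun j => ?_
  obtain ⟨f, hf, hupper, hlower⟩ := hint c hc0 hslow z hz (residueClass N j)
    fun n hn m hm hne => le_latticeNorm_of_mem_residueClass hn hm hne
  have hfin : ∫⁻ w, weightedModulus α f w ^ p ∂μ ≠ ∞ := by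
    refine ne_top_of_le_ne_top (ENNReal.mul_ne_top (a := ENNReal.ofReal B ^ p) (by finiteness)
      hyfin) ((lintegral_le_tsum_tile hr μ _).trans ?_)
    rw [← ENNReal.tsum_mul_left]
    refine ENNReal.tsum_le_tsum fun n => ?_
    calc ∫⁻ w in square (tileCenter r n) r, weightedModulus α f w ^ p ∂μ
        ≤ ∫⁻ w in square (tileCenter r n) r, (ENNReal.ofReal B * ENNReal.ofReal (c n)) ^ p ∂μ := by
          refine setLIntegral_mono' (measurableSet_square _ _) fun w hw => ?_
          gcongr
          rw [← ENNReal.ofReal_mul' (hc0 n)]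
          exact ENNReal.ofReal_le_ofReal (hupper n w hw)
      _ = ENNReal.ofReal B ^ p * (y n * μ (square (tileCenter r n) r)) := by
          rw [setLIntegral_const, ENNReal.mul_rpow_of_nonneg _ _ hp.le, hcy n p hp,
            div_self hp.ne', ENNReal.rpow_one, mul_assoc]
  have hgf := hmul f hf hfin
  have hκ' : ENNReal.ofReal κ ≠ 0 := by simpa using hκ
  set D : ℝ≥0∞ := (ENNReal.ofReal κ ^ q)⁻¹ with hD
  have hDfin : D ≠ ∞ := by
    rw [hD, ENNReal.inv_ne_top]
    exact (ENNReal.rpow_pos (pos_iff_ne_zero.2 hκ') ENNReal.ofReal_ne_top).ne'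
  have hDmul : D * ENNReal.ofReal κ ^ q = 1 := by
    rw [hD, ENNReal.inv_mul_cancel _ (by finiteness)]
    exact (ENNReal.rpow_pos (pos_iff_ne_zero.2 hκ') ENNReal.ofReal_ne_top).ne'
  have hgmeas : Measurable fun w => weightedModulus (β - α) g w ^ q :=
    (continuous_weightedModulus hg.continuous).measurable.pow_const q
  -- The value of g at z_n is replaced by an integral over the square around z_n, where the test
  -- function is bounded below.
  have hlocal : ∀ n ∈ residueClass N j, x n ^ (q / p) *
      (weightedModulus (β - α) g (z n) ^ q * μ (square (tileCenter r n) r)) ≤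
      D * K₁ * C₂ *
        ∫⁻ w in square (z n) r, weightedModulus β (fun w => g w * f w) w ^ q ∂μ := by
    intro n hn
    have hμ : μ (square (tileCenter r n) r) ≤ K₁ * μ (square (z n) r) := by
      have := hdoub 1 (tileCenter r n) (z n) (by simpa [abs_sub_comm] using (hz n).1)
        (by simpa [abs_sub_comm] using (hz n).2)
      simpa using this
    have hlow : ENNReal.ofReal κ ^ q * y n ^ (q / p) *
        ∫⁻ w in square (z n) r, weightedModulus (β - α) g w ^ q ∂μ ≤
        ∫⁻ w in square (z n) r, weightedModulus β (fun w => g w * f w) w ^ q ∂μ := by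
      rw [← lintegral_const_mul _ hgmeas]
      refine setLIntegral_mono' (measurableSet_square _ _) fun w hw => ?_
      rw [weightedModulus_mul α β f g w, ENNReal.mul_rpow_of_nonneg _ _ hq.le,
        mul_comm (weightedModulus (β - α) g w ^ q), ← hcy n q hq,
        ← ENNReal.mul_rpow_of_nonneg _ _ hq.le, ← ENNReal.ofReal_mul hκ.le]
      gcongr
      exact ofReal_mul_le_weightedModulus (hlower n hn w hw)
    calc x n ^ (q / p) *
          (weightedModulus (β - α) g (z n) ^ q * μ (square (tileCenter r n) r))
        ≤ y n ^ (q / p) *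
          (weightedModulus (β - α) g (z n) ^ q * (K₁ * μ (square (z n) r))) := by
          gcongr
          exact hxy n
      _ = y n ^ (q / p) * K₁ *
          (weightedModulus (β - α) g (z n) ^ q * μ (square (z n) r)) := by ring
      _ ≤ y n ^ (q / p) * K₁ *
          (C₂ * ∫⁻ w in square (z n) r, weightedModulus (β - α) g w ^ q ∂μ) := by
          exact mul_le_mul_right (hsub g hg (z n)) _
      _ = K₁ * C₂ * (D * ENNReal.ofReal κ ^ q) * (y n ^ (q / p) *
          ∫⁻ w in square (z n) r, weightedModulus (β - α) g w ^ q ∂μ) := by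
          rw [hDmul]; ring
      _ = D * K₁ * C₂ * (ENNReal.ofReal κ ^ q * y n ^ (q / p) *
          ∫⁻ w in square (z n) r, weightedModulus (β - α) g w ^ q ∂μ) := by ring
      _ ≤ _ := mul_le_mul_right hlow _
  have hdisj : Pairwise (Function.onFun Disjoint
      fun n : residueClass N j => square (z n) r) := by
    intro n m hnm
    exact disjoint_square_of_separated hr hz (hN.trans
      (le_latticeNorm_of_mem_residueClass n.2 m.2 fun h => hnm (Subtype.ext h)))
  refine ne_top_of_le_ne_top (ENNReal.mul_ne_top (a := D * K₁ * C₂) (by finiteness) hgf) ?_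
  calc _ ≤ ∑' n : residueClass N j, D * K₁ * C₂ *
        ∫⁻ w in square (z n) r, weightedModulus β (fun w => g w * f w) w ^ q ∂μ :=
        ENNReal.tsum_le_tsum fun n => hlocal n n.2
    _ = D * K₁ * C₂ * ∫⁻ w in ⋃ n : residueClass N j, square (z n) r,
          weightedModulus β (fun w => g w * f w) w ^ q ∂μ := by
        rw [ENNReal.tsum_mul_left,
          lintegral_iUnion (fun n => measurableSet_square _ _) hdisj]
    _ ≤ _ := mul_le_mul_right (setLIntegral_le_lintegral _ _) _

/-! ### From the necessary condition to growth and integrability of the multiplier -/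

theorem mem_fockSpace_iff {ω : ℂ → ℝ} (hω : IsWeight ω) {p : ℝ} (hp : 0 < p) (α : ℝ)
    (f : ℂ → ℂ) :
    f ∈ fockSpace p α ω ↔
      Differentiable ℂ f ∧ ∫⁻ z, weightedModulus α f z ^ p ∂(weightMeasure ω) ≠ ∞ := by
  have hint : ∫⁻ z, weightedModulus α f z ^ p ∂(weightMeasure ω) = ∫⁻ z : ℂ, ENNReal.ofReal
      (‖f z‖ ^ p * Real.exp (-(p * (α / 2) * ‖z‖ ^ 2)) * ω z) := by
    rw [weightMeasure, lintegral_withDensity_eq_lintegral_mul_non_measurable₀ _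
      hω.aemeasurable_ofReal (by simp)]
    refine lintegral_congr fun z => ?_
    rw [Pi.mul_apply, weightedModulus, ENNReal.ofReal_rpow_of_nonneg (by positivity) hp.le,
      ← ENNReal.ofReal_mul (hω.nonneg z), Real.mul_rpow (norm_nonneg _) (Real.exp_pos _).le,
      ← Real.exp_mul]
    ring_nf
  constructor
  · rintro ⟨⟨-, h⟩, hf⟩
    exact ⟨hf, hint ▸ h.ne⟩
  · rintro ⟨hf, h⟩
    exact ⟨⟨hf.continuous.aestronglyMeasurable, (hint ▸ h).lt_top⟩, hf⟩

theorem isCompact_square (z : ℂ) (r : ℝ) : IsCompact (square z r) := by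
  refine Metric.isCompact_of_isClosed_isBounded ?_
    (Metric.isBounded_closedBall.subset (square_subset_closedBall z r))
  refine IsClosed.inter (s₁ := {w : ℂ | |w.re - z.re| ≤ r / 2})
    (s₂ := {w : ℂ | |w.im - z.im| ≤ r / 2}) ?_ ?_
  · exact isClosed_le (by fun_prop) continuous_const
  · exact isClosed_le (by fun_prop) continuous_const

/-- Continuous functions attain their maximum on each tile. -/
theorem exists_max_on_tiles {r : ℝ} (hr : 0 < r) {F : ℂ → ℝ≥0∞} (hF : Continuous F) :
    ∃ z : ℤ × ℤ → ℂ, (∀ n, z n ∈ square (tileCenter r n) r) ∧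
      ∀ n, ∀ w ∈ square (tileCenter r n) r, F w ≤ F (z n) := by
  have h : ∀ n : ℤ × ℤ, ∃ z ∈ square (tileCenter r n) r,
      ∀ w ∈ square (tileCenter r n) r, F w ≤ F z := fun n =>
    (isCompact_square _ r).exists_isMaxOn
      ⟨tileCenter r n, mem_square_of_norm_sub_le (by simpa using (half_pos hr).le)⟩ hF.continuousOn
  choose z hz hmax using h
  exact ⟨z, hz, hmax⟩

namespace IsMuckenhoupt

variable {μ : Measure ℂ} {r P : ℝ}

/-- Gaussians are integrable. -/
theorem lintegral_weightedModulus_one_ne_top (h : IsMuckenhoupt μ r P) {α p : ℝ} (hα : 0 < α)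
    (hp : 0 < p) : ∫⁻ w, weightedModulus α (fun _ => 1) w ^ p ∂μ ≠ ∞ := by
  have hr := h.r_pos
  obtain ⟨K, hKt, hK1, hK⟩ := h.exists_measure_tile_le
  lift K to NNReal using hKt
  have hK1' : 1 ≤ (K : ℝ) := by exact_mod_cast hK1
  -- The rate log(2K) gives decay (2K)^(-|n|), which beats the growth K^|n| of the tile masses.
  obtain ⟨G, hG, hgauss⟩ := exists_gaussian_le (mul_pos hp hα) hr (A := Real.log (2 * K))
    (Real.log_nonneg (by linarith)) r
  have h0 : (0 : ℂ) ∈ square (tileCenter r 0) r := by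
    simpa [square, tileCenter] using (half_pos hr).le
  have hexp : ∀ k : ℕ, Real.exp (-(Real.log (2 * K) * k)) = (2 * (K : ℝ))⁻¹ ^ k := by
    intro k
    rw [← neg_mul, mul_comm, Real.exp_nat_mul, Real.exp_neg, Real.exp_log (by linarith)]
  refine ne_top_of_le_ne_top (ENNReal.mul_ne_top (ENNReal.mul_ne_top (ENNReal.ofReal_ne_top (r := G))
    (h.ne_top (tileCenter r 0))) tsum_pow_latticeNorm_ne_top)
    ((lintegral_le_tsum_tile hr μ _).trans ?_)
  rw [← ENNReal.tsum_mul_left]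
  refine ENNReal.tsum_le_tsum fun n => ?_
  have hpt : ∀ w ∈ square (tileCenter r n) r, weightedModulus α (fun _ => 1) w ^ p ≤
      ENNReal.ofReal G * (2 * (K : ℝ≥0∞))⁻¹ ^ latticeNorm n := by
    intro w hw
    have h1 := hgauss 0 n 0 w h0 (norm_sub_le_of_mem_square hw)
    rw [hexp, sub_zero, latticeNorm_sub_comm, sub_zero] at h1
    rw [weightedModulus, ENNReal.ofReal_rpow_of_nonneg (by positivity) hp.le]
    have hcast : (2 * (K : ℝ≥0∞))⁻¹ = ENNReal.ofReal (2 * (K : ℝ))⁻¹ := by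
      rw [ENNReal.ofReal_inv_of_pos (by linarith), ENNReal.ofReal_mul (by norm_num)]
      simp
    rw [hcast, ← ENNReal.ofReal_pow (by positivity), ← ENNReal.ofReal_mul hG.le]
    refine ENNReal.ofReal_le_ofReal (le_trans (le_of_eq ?_) h1)
    rw [norm_one, one_mul, ← Real.exp_mul]
    ring_nf
  have hKK : (2 * (K : ℝ≥0∞))⁻¹ * K = 2⁻¹ := by
    have hK0 : K ≠ 0 := by
      rintro rfl
      norm_num at hK1'
    rw [ENNReal.mul_inv (by simp) (by simp), mul_assoc,
      ENNReal.inv_mul_cancel (by exact_mod_cast hK0) ENNReal.coe_ne_top, mul_one]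
  calc ∫⁻ w in square (tileCenter r n) r, weightedModulus α (fun _ => 1) w ^ p ∂μ
      ≤ ∫⁻ w in square (tileCenter r n) r,
          ENNReal.ofReal G * (2 * (K : ℝ≥0∞))⁻¹ ^ latticeNorm n ∂μ :=
        setLIntegral_mono' (measurableSet_square _ _) hpt
    _ = ENNReal.ofReal G * (2 * (K : ℝ≥0∞))⁻¹ ^ latticeNorm n * μ (square (tileCenter r n) r) :=
        setLIntegral_const _ _
    _ ≤ ENNReal.ofReal G * (2 * (K : ℝ≥0∞))⁻¹ ^ latticeNorm n *
          (K ^ latticeNorm n * μ (square (tileCenter r 0) r)) := by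
        gcongr
        simpa using hK n 0
    _ = ENNReal.ofReal G * μ (square (tileCenter r 0) r) *
          ((2 * (K : ℝ≥0∞))⁻¹ * K) ^ latticeNorm n := by rw [mul_pow]; ring
    _ = _ := by rw [hKK]

/-- Test the uniform bound on the sequence supported on a single tile, with value the inverse of its
mass. -/
theorem exists_le_measure_square_rpow_of_multiplier (h : IsMuckenhoupt μ r P) {α β p q : ℝ}
    (hα : 0 < α) (hp : 0 < p) (hpq : p ≤ q) {g : ℂ → ℂ} (hg : Differentiable ℂ g)
    (hmul : ∀ f : ℂ → ℂ, Differentiable ℂ f → ∫⁻ w, weightedModulus α f w ^ p ∂μ ≠ ∞ →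
      ∫⁻ w, weightedModulus β (fun w => g w * f w) w ^ q ∂μ ≠ ∞) :
    ∃ C : ℝ≥0∞, C ≠ ∞ ∧
      ∀ u, weightedModulus (β - α) g u ^ q ≤ C * μ (square u r) ^ (q / p - 1) := by
  have hr := h.r_pos
  have hq := hp.trans_le hpq
  have he : 0 ≤ q / p - 1 := by rw [sub_nonneg, one_le_div hp]; exact hpq
  obtain ⟨z, hz, hmax⟩ := exists_max_on_tiles hr
    (continuous_weightedModulus (α := β - α) hg.continuous)
  obtain ⟨C, hC, hbd⟩ := exists_bound_of_tsum_ne_top (div_pos hq hp)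
    (h.tsum_ne_top_of_multiplier hα hp hq hg hmul hz)
  obtain ⟨K, hK, -, hdoub⟩ := h.exists_doubling
  refine ⟨C * K ^ (q / p - 1), by finiteness, fun u => ?_⟩
  obtain ⟨n, hn⟩ := exists_mem_tile hr u
  set W := μ (square (tileCenter r n) r) with hW
  have hW0 : W ≠ 0 := h.ne_zero _
  have hWt : W ≠ ∞ := h.ne_top _
  have hWK : W ≤ K * μ (square u r) := by
    simpa using hdoub 1 (tileCenter r n) u (by simpa [abs_sub_comm] using hn.1)
      (by simpa [abs_sub_comm] using hn.2)
  have h1 : W⁻¹ ^ (q / p) * (weightedModulus (β - α) g (z n) ^ q * W) ≤ C := by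
    classical
    refine le_trans ?_ (hbd (Pi.single n W⁻¹) ?_)
    · refine le_trans (le_of_eq ?_) (ENNReal.le_tsum n)
      rw [Pi.single_eq_same]
    · rw [tsum_eq_single n fun m hm => by rw [Pi.single_eq_of_ne hm, zero_mul], Pi.single_eq_same,
        ENNReal.inv_mul_cancel hW0 hWt]
  calc weightedModulus (β - α) g u ^ q ≤ weightedModulus (β - α) g (z n) ^ q := by
        gcongr
        exact hmax n u hn
    _ = W⁻¹ ^ (q / p) * (weightedModulus (β - α) g (z n) ^ q * W) * W ^ (q / p - 1) := by
        have e1 : W * W ^ (q / p - 1) = W ^ (q / p) := by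
          conv_lhs => rw [← ENNReal.rpow_one W]
          rw [← ENNReal.rpow_mul, ← ENNReal.rpow_add _ _ hW0 hWt]
          ring_nf
        have e2 : W⁻¹ ^ (q / p) * W ^ (q / p) = 1 := by
          rw [← ENNReal.mul_rpow_of_nonneg _ _ (by positivity), ENNReal.inv_mul_cancel hW0 hWt,
            ENNReal.one_rpow]
        calc _ = weightedModulus (β - α) g (z n) ^ q * (W⁻¹ ^ (q / p) * W ^ (q / p)) := by
              rw [e2, mul_one]
          _ = _ := by rw [← e1]; ring
    _ ≤ C * (K * μ (square u r)) ^ (q / p - 1) := by gcongr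
    _ = _ := by rw [ENNReal.mul_rpow_of_nonneg _ _ he, mul_assoc]

/-- Test the uniform bound on the normalized sequence a_n^s; the identity sq/p + q = s reproduces
the same sum on both sides. -/
theorem lintegral_ne_top_of_multiplier (h : IsMuckenhoupt μ r P) {α β p q : ℝ} (hα : 0 < α)
    (hq : 0 < q) (hqp : q < p) {g : ℂ → ℂ} (hg : Differentiable ℂ g)
    (hmul : ∀ f : ℂ → ℂ, Differentiable ℂ f → ∫⁻ w, weightedModulus α f w ^ p ∂μ ≠ ∞ →
      ∫⁻ w, weightedModulus β (fun w => g w * f w) w ^ q ∂μ ≠ ∞) :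
    ∫⁻ w, weightedModulus (β - α) g w ^ (p * q / (p - q)) ∂μ ≠ ∞ := by
  have hr := h.r_pos
  have hp := hq.trans hqp
  have hpq : 0 < p - q := sub_pos.2 hqp
  set s := p * q / (p - q) with hs
  have hs0 : 0 < s := by positivity
  have hθ : 0 < 1 - q / p := by rw [sub_pos, div_lt_one hp]; exact hqp
  obtain ⟨z, hz, hmax⟩ := exists_max_on_tiles hr
    (continuous_weightedModulus (α := β - α) hg.continuous)
  obtain ⟨C, hC, hbd⟩ := exists_bound_of_tsum_ne_top (div_pos hq hp)
    (h.tsum_ne_top_of_multiplier hα hp hq hg hmul hz)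
  set a : ℤ × ℤ → ℝ≥0∞ := fun n => weightedModulus (β - α) g (z n) with ha
  set W : ℤ × ℤ → ℝ≥0∞ := fun n => μ (square (tileCenter r n) r) with hW
  have hat : ∀ n, a n ≠ ∞ := fun n => weightedModulus_ne_top _ _ _
  have hWt : ∀ n, W n ≠ ∞ := fun n => h.ne_top _
  -- Truncating to finite sets keeps the sum D finite, so it can be divided out: D^(1 - q/p) ≤ C.
  have hfinset : ∀ B : Finset (ℤ × ℤ), ∑ n ∈ B, a n ^ s * W n ≤ C ^ (1 / (1 - q / p)) := by
    intro B
    set D := ∑ n ∈ B, a n ^ s * W n with hD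
    rcases eq_or_ne D 0 with hD0 | hD0
    · rw [hD0]; exact zero_le
    have hDt : D ≠ ∞ := ENNReal.sum_ne_top.2 fun n _ =>
      ENNReal.mul_ne_top (ENNReal.rpow_ne_top_of_nonneg hs0.le (hat n)) (hWt n)
    classical
    have h1 : D ^ (1 - q / p) ≤ C := by
      refine le_trans ?_ (hbd (fun n => if n ∈ B then D⁻¹ * a n ^ s else 0) ?_)
      · refine le_trans ?_ (ENNReal.sum_le_tsum B)
        have hterm : ∀ n ∈ B, (if n ∈ B then D⁻¹ * a n ^ s else 0) ^ (q / p) * (a n ^ q * W n) =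
            D⁻¹ ^ (q / p) * (a n ^ s * W n) := by
          intro n hn
          rw [if_pos hn, ENNReal.mul_rpow_of_nonneg _ _ (by positivity), ← ENNReal.rpow_mul]
          have e : a n ^ (s * (q / p)) * a n ^ q = a n ^ s := by
            rw [← ENNReal.rpow_add_of_nonneg _ _ (by positivity) hq.le]
            congr 1
            rw [hs]; field_simp; ring
          rw [← e]; ring
        rw [Finset.sum_congr rfl hterm, ← Finset.mul_sum, ← hD, sub_eq_add_neg,
          ENNReal.rpow_add _ _ hD0 hDt, ENNReal.rpow_one, ENNReal.rpow_neg, ENNReal.inv_rpow,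
          mul_comm]
      · rw [tsum_eq_sum (s := B) fun n hn => by rw [if_neg hn, zero_mul]]
        have hterm : ∀ n ∈ B, (if n ∈ B then D⁻¹ * a n ^ s else 0) * W n =
            D⁻¹ * (a n ^ s * W n) := by
          intro n hn
          rw [if_pos hn, mul_assoc]
        rw [Finset.sum_congr rfl hterm, ← Finset.mul_sum, ← hD, ENNReal.inv_mul_cancel hD0 hDt]
    calc D = (D ^ (1 - q / p)) ^ (1 / (1 - q / p)) := by
          rw [← ENNReal.rpow_mul, mul_one_div_cancel hθ.ne', ENNReal.rpow_one]
      _ ≤ _ := by gcongr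
  have hsum : ∑' n, a n ^ s * W n ≤ C ^ (1 / (1 - q / p)) := by
    rw [ENNReal.tsum_eq_iSup_sum]
    exact iSup_le hfinset
  refine ne_top_of_le_ne_top (by finiteness) ((lintegral_le_tsum_tile hr μ _).trans
    (le_trans (ENNReal.tsum_le_tsum fun n => ?_) hsum))
  rw [← setLIntegral_const]
  refine setLIntegral_mono' (measurableSet_square _ _) fun w hw => ?_
  gcongr
  exact hmax n w hw

end IsMuckenhoupt

/-- Both a^s and b^p are at most their sum, and the exponents q/s and q/p add up to 1. -/
theorem mul_rpow_le_add {a b : ℝ≥0∞} {p q : ℝ} (hq : 0 < q) (hqp : q < p) :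
    (a * b) ^ q ≤ a ^ (p * q / (p - q)) + b ^ p := by
  have hp := hq.trans hqp
  have hpq : 0 < p - q := sub_pos.2 hqp
  set s := p * q / (p - q) with hs
  have hs0 : 0 < s := by positivity
  calc (a * b) ^ q = (a ^ s) ^ (q / s) * (b ^ p) ^ (q / p) := by
        rw [ENNReal.mul_rpow_of_nonneg _ _ hq.le, ← ENNReal.rpow_mul, ← ENNReal.rpow_mul,
          mul_div_cancel₀ _ hs0.ne', mul_div_cancel₀ _ hp.ne']
    _ ≤ (a ^ s + b ^ p) ^ (q / s) * (a ^ s + b ^ p) ^ (q / p) := by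
        gcongr
        · exact le_self_add
        · exact le_add_self
    _ = (a ^ s + b ^ p) ^ (1 : ℝ) := by
        rw [← ENNReal.rpow_add_of_nonneg _ _ (by positivity) (by positivity)]
        congr 1
        rw [hs]; field_simp; ring
    _ = _ := ENNReal.rpow_one _

/-! ### Identification of the multiplier spaces -/

section Multipliers

variable {ω : ℂ → ℝ} {α β p q : ℝ} {g : ℂ → ℂ}

/-- Multipliers between weighted Fock spaces are entire. -/
theorem multiplier_entire (hω : IsAInftyRestricted ω) (hα : 0 < α) (hp : 0 < p)
    (hg : g ∈ Mult (fockSpace p α ω) (fockSpace q β ω)) : Differentiable ℂ g := by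
  obtain ⟨r, P, hM⟩ := hω.isMuckenhoupt
  -- Constants lie in the space, so a multiplier is itself the image of an entire function.
  have h1 : (fun _ => 1 : ℂ → ℂ) ∈ fockSpace p α ω :=
    (mem_fockSpace_iff hω.isWeight hp α _).2
      ⟨differentiable_const _, hM.lintegral_weightedModulus_one_ne_top hα hp⟩
  simpa [entire] using (hg _ h1).2

theorem mem_mult_iff (hω : IsAInftyRestricted ω) (hα : 0 < α) (hp : 0 < p) (hq : 0 < q) :
    g ∈ Mult (fockSpace p α ω) (fockSpace q β ω) ↔ Differentiable ℂ g ∧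
      ∀ f : ℂ → ℂ, Differentiable ℂ f →
        ∫⁻ w, weightedModulus α f w ^ p ∂(weightMeasure ω) ≠ ∞ →
        ∫⁻ w, weightedModulus β (fun w => g w * f w) w ^ q ∂(weightMeasure ω) ≠ ∞ := by
  constructor
  · intro hg
    exact ⟨multiplier_entire hω hα hp hg, fun f hf hfin =>
      ((mem_fockSpace_iff hω.isWeight hq β _).1
        (hg f ((mem_fockSpace_iff hω.isWeight hp α f).2 ⟨hf, hfin⟩))).2⟩
  · rintro ⟨hg, h⟩ f hf
    obtain ⟨hf', hfin⟩ := (mem_fockSpace_iff hω.isWeight hp α f).1 hf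
    exact (mem_fockSpace_iff hω.isWeight hq β _).2 ⟨hg.mul hf', h f hf' hfin⟩

/-- For equal exponents the power of the mass in the one-tile estimate is zero, leaving a uniform
bound. -/
theorem mult_eq_fockSpaceInfty (hω : IsAInftyRestricted ω) (hα : 0 < α) (hp : 0 < p) :
    Mult (fockSpace p α ω) (fockSpace p β ω) = fockSpaceInfty (β - α) := by
  obtain ⟨r, P, hM⟩ := hω.isMuckenhoupt
  ext g
  rw [mem_mult_iff hω hα hp hp]
  constructor
  · rintro ⟨hg, hmul⟩
    obtain ⟨C, hC, hb⟩ := hM.exists_le_measure_square_rpow_of_multiplier hα hp le_rfl hg hmul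
    refine ⟨hg, (C ^ (1 / p)).toReal, ?_⟩
    rintro _ ⟨u, rfl⟩
    have h1 := hb u
    rw [div_self hp.ne', sub_self, ENNReal.rpow_zero, mul_one] at h1
    have h2 : weightedModulus (β - α) g u ≤ C ^ (1 / p) := by
      rw [one_div, ENNReal.le_rpow_inv_iff hp]
      exact h1
    exact (ENNReal.ofReal_le_iff_le_toReal (by finiteness)).1 h2
  · rintro ⟨hg, M, hM'⟩
    refine ⟨hg, fun f hf hfin => ?_⟩
    refine ne_top_of_le_ne_top (ENNReal.mul_ne_top (a := ENNReal.ofReal M ^ p) (by finiteness)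
      hfin) ?_
    rw [← lintegral_const_mul' _ _ (by finiteness)]
    refine lintegral_mono fun w => ?_
    rw [weightedModulus_mul α β f g w, ENNReal.mul_rpow_of_nonneg _ _ hp.le]
    gcongr
    exact ENNReal.ofReal_le_ofReal (hM' ⟨w, rfl⟩)

theorem fockSpaceInfty_zero : fockSpaceInfty 0 = {g | ∃ c : ℂ, g = fun _ => c} := by
  ext g
  constructor
  · rintro ⟨hg, M, hM⟩
    have hb : Bornology.IsBounded (Set.range g) := by
      rw [isBounded_iff_forall_norm_le]
      refine ⟨M, ?_⟩
      rintro _ ⟨u, rfl⟩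
      simpa using hM ⟨u, rfl⟩
    obtain ⟨c, hc⟩ := Differentiable.exists_const_forall_eq_of_bounded hg hb
    exact ⟨c, funext hc⟩
  · rintro ⟨c, rfl⟩
    refine ⟨differentiable_const c, ‖c‖, ?_⟩
    rintro _ ⟨u, rfl⟩
    simp

theorem mem_mult_iff_of_lt (hω : IsAInftyRestricted ω) (hα : 0 < α) (hp : 0 < p)
    (hpq : p < q) :
    g ∈ Mult (fockSpace p α ω) (fockSpace q β ω) ↔ g ∈ entire ∧ ∃ C : ℝ, 0 < C ∧ ∀ u : ℂ,
      ‖g u‖ * Real.exp ((α - β) / 2 * ‖u‖ ^ 2) ≤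
        C * (weightMeasure ω).real (Metric.ball u 1) ^ ((q - p) / (p * q)) := by
  obtain ⟨r, P, hM⟩ := hω.isMuckenhoupt
  set μ := weightMeasure ω with hμ
  have hq := hp.trans hpq
  have he : 0 < q / p - 1 := by rw [sub_pos, one_lt_div hp]; exact hpq
  have hball : ∀ u, μ (Metric.ball u 1) ≠ ∞ := fun u =>
    hω.isWeight.weightMeasure_ne_top Metric.ball_subset_closedBall
  have hd : 0 < (q - p) / (p * q) := div_pos (sub_pos.2 hpq) (by positivity)
  have hde : (q - p) / (p * q) * q = q / p - 1 := by field_simp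
  have hexp : ∀ u, weightedModulus (β - α) g u =
      ENNReal.ofReal (‖g u‖ * Real.exp ((α - β) / 2 * ‖u‖ ^ 2)) := by
    intro u
    rw [weightedModulus]
    ring_nf
  rw [mem_mult_iff hω hα hp hq]
  constructor
  · rintro ⟨hg, hmul⟩
    obtain ⟨C, hC, hb⟩ := hM.exists_le_measure_square_rpow_of_multiplier hα hp hpq.le hg hmul
    obtain ⟨K, hK, hKb⟩ := hM.exists_measure_square_le_ball
    -- Adding 1 makes the constant strictly positive.
    refine ⟨hg, ((C * K ^ (q / p - 1)) ^ q⁻¹).toReal + 1, by positivity, fun u => ?_⟩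
    have h1 : weightedModulus (β - α) g u ≤
        (C * K ^ (q / p - 1)) ^ q⁻¹ * μ (Metric.ball u 1) ^ ((q - p) / (p * q)) := by
      have h2 : μ (Metric.ball u 1) ^ ((q - p) / (p * q)) =
          (μ (Metric.ball u 1) ^ (q / p - 1)) ^ q⁻¹ := by
        rw [← ENNReal.rpow_mul, ← hde, mul_inv_cancel_right₀ hq.ne']
      rw [h2, ← ENNReal.mul_rpow_of_nonneg _ _ (by positivity), ENNReal.le_rpow_inv_iff hq,
        mul_assoc, ← ENNReal.mul_rpow_of_nonneg _ _ he.le]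
      refine (hb u).trans ?_
      gcongr
      exact hKb u
    rw [hexp, ENNReal.ofReal_le_iff_le_toReal (ENNReal.mul_ne_top (by finiteness)
      (ENNReal.rpow_ne_top_of_nonneg hd.le (hball u))), ENNReal.toReal_mul] at h1
    refine h1.trans ?_
    rw [Measure.real, ENNReal.toReal_rpow]
    gcongr
    linarith
  · rintro ⟨hg, C, hC, hb⟩
    refine ⟨hg, fun f hf hfin => ?_⟩
    obtain ⟨C₁, hC₁, hsub⟩ := hM.exists_weightedModulus_rpow_le hp α
    obtain ⟨K, hK, hKb⟩ := hM.exists_measure_ball_le_square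
    set I := ∫⁻ w, weightedModulus α f w ^ p ∂μ with hI
    refine ne_top_of_le_ne_top (ENNReal.mul_ne_top
      (a := ENNReal.ofReal C ^ q * (K * (C₁ * I)) ^ (q / p - 1)) (by finiteness) hfin) ?_
    rw [hI, ← lintegral_const_mul' _ _ (by finiteness)]
    refine lintegral_mono fun w => ?_
    have hgw : weightedModulus (β - α) g w ^ q ≤
        ENNReal.ofReal C ^ q * μ (Metric.ball w 1) ^ (q / p - 1) := by
      rw [← hde, ENNReal.rpow_mul, ← ENNReal.mul_rpow_of_nonneg _ _ hq.le]
      gcongr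
      rw [hexp]
      refine (ENNReal.ofReal_le_ofReal (hb w)).trans (le_of_eq ?_)
      rw [ENNReal.ofReal_mul hC.le, ← ENNReal.ofReal_rpow_of_nonneg measureReal_nonneg hd.le,
        ofReal_measureReal (hball w)]
    have hfw : μ (Metric.ball w 1) * weightedModulus α f w ^ p ≤ K * (C₁ * I) := by
      calc _ ≤ K * μ (square w r) * weightedModulus α f w ^ p := by
            gcongr
            exact hKb w
        _ = K * (weightedModulus α f w ^ p * μ (square w r)) := by ring
        _ ≤ K * (C₁ * ∫⁻ w in square w r, weightedModulus α f w ^ p ∂μ) :=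
            mul_le_mul_right (hsub f hf w) _
        _ ≤ _ := mul_le_mul_right (mul_le_mul_right (setLIntegral_le_lintegral _ _) _) _
    -- The factor of exponent q - p pairs with the mass of the disc and is bounded pointwise; the
    -- remaining p-th power is integrated.
    have hsplit : weightedModulus α f w ^ q =
        (weightedModulus α f w ^ p) ^ (q / p - 1) * weightedModulus α f w ^ p := by
      rw [← ENNReal.rpow_mul, ← ENNReal.rpow_add_of_nonneg _ _ (by positivity) hp.le]
      congr 1
      field_simp
      ring
    calc weightedModulus β (fun w => g w * f w) w ^ q
        = weightedModulus (β - α) g w ^ q * weightedModulus α f w ^ q := by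
          rw [weightedModulus_mul α β f g w, ENNReal.mul_rpow_of_nonneg _ _ hq.le]
      _ ≤ ENNReal.ofReal C ^ q * μ (Metric.ball w 1) ^ (q / p - 1) *
          ((weightedModulus α f w ^ p) ^ (q / p - 1) * weightedModulus α f w ^ p) := by
          rw [hsplit]
          gcongr
      _ = ENNReal.ofReal C ^ q * (μ (Metric.ball w 1) * weightedModulus α f w ^ p) ^ (q / p - 1) *
          weightedModulus α f w ^ p := by
          rw [ENNReal.mul_rpow_of_nonneg _ _ he.le]; ring
      _ ≤ _ := by gcongr

theorem mult_eq_fockSpace (hω : IsAInftyRestricted ω) (hα : 0 < α) (hq : 0 < q) (hqp : q < p) :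
    Mult (fockSpace p α ω) (fockSpace q β ω) = fockSpace (p * q / (p - q)) (β - α) ω := by
  obtain ⟨r, P, hM⟩ := hω.isMuckenhoupt
  have hp := hq.trans hqp
  have hs : 0 < p * q / (p - q) := div_pos (by positivity) (sub_pos.2 hqp)
  ext g
  rw [mem_mult_iff hω hα hp hq, mem_fockSpace_iff hω.isWeight hs]
  refine and_congr_right fun hg => ⟨hM.lintegral_ne_top_of_multiplier hα hq hqp hg,
    fun hgfin f hf hfin => ?_⟩
  refine ne_top_of_le_ne_top (ENNReal.add_ne_top.2 ⟨hgfin, hfin⟩) ?_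
  rw [← lintegral_add_left
    ((continuous_weightedModulus hg.continuous).measurable.pow_const _)]
  refine lintegral_mono fun w => ?_
  rw [weightedModulus_mul α β f g w]
  exact mul_rpow_le_add hq hqp

theorem fockSpace_zero_eq (hω : IsWeight ω) (hp : 0 < p) :
    fockSpace p 0 ω = entire ∩ {g | MemLp g (ENNReal.ofReal p) (weightMeasure ω)} := by
  ext g
  rw [mem_fockSpace_iff hω hp]
  refine and_congr_right fun hg => ?_
  have hw : ∀ z, weightedModulus 0 g z = ‖g z‖ₑ := fun z => by
    rw [weightedModulus, ← ofReal_norm]; simp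
  have hmeas : AEStronglyMeasurable g (weightMeasure ω) :=
    (Differentiable.continuous hg).aestronglyMeasurable
  simp_rw [hw, Set.mem_ofPred_eq, MemLp, hmeas, true_and]
  rw [eLpNorm_lt_top_iff_lintegral_rpow_enorm_lt_top (by simpa using hp) ENNReal.ofReal_ne_top,
    ENNReal.toReal_ofReal hp.le, lt_top_iff_ne_top]

end Multipliers

end WeightedFock

theorem theorem5 (α β : ℝ) (hα : 0 < α) (hβ : 0 < β) (ω : ℂ → ℝ)
    (hω : WeightedFock.IsAInftyRestricted ω) :
    (∀ p : ℝ, 0 < p → α < β →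
      WeightedFock.Mult (WeightedFock.fockSpace p α ω) (WeightedFock.fockSpace p β ω) =
        WeightedFock.fockSpaceInfty (β - α)) ∧
    (∀ p : ℝ, 0 < p →
      WeightedFock.Mult (WeightedFock.fockSpace p α ω) (WeightedFock.fockSpace p α ω) =
        {g | ∃ c : ℂ, g = fun _ => c}) ∧
    (∀ p q : ℝ, 0 < p → p < q → α ≤ β →
      WeightedFock.Mult (WeightedFock.fockSpace p α ω) (WeightedFock.fockSpace q β ω) =
        {g | g ∈ WeightedFock.entire ∧ ∃ C : ℝ, 0 < C ∧ ∀ u : ℂ,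
          ‖g u‖ * Real.exp ((α - β) / 2 * ‖u‖ ^ 2) ≤
            C * (WeightedFock.weightMeasure ω).real (Metric.ball u 1) ^ ((q - p) / (p * q))}) ∧
    (∀ p q : ℝ, 0 < q → q < p → α < β →
      WeightedFock.Mult (WeightedFock.fockSpace p α ω) (WeightedFock.fockSpace q β ω) =
        WeightedFock.fockSpace (p * q / (p - q)) (β - α) ω) ∧
    (∀ p q : ℝ, 0 < q → q < p →
      WeightedFock.Mult (WeightedFock.fockSpace p α ω) (WeightedFock.fockSpace q α ω) =
        WeightedFock.entire ∩
          {g | MemLp g (ENNReal.ofReal (p * q / (p - q))) (WeightedFock.weightMeasure ω)}) := by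
  exact ⟨fun _ hp _ => WeightedFock.mult_eq_fockSpaceInfty hω hα hp,
    fun _ hp => by
      rw [WeightedFock.mult_eq_fockSpaceInfty hω hα hp, sub_self,
        WeightedFock.fockSpaceInfty_zero],
    fun _ _ hp hpq _ => Set.ext fun _ => WeightedFock.mem_mult_iff_of_lt hω hα hp hpq,
    fun _ _ hq hqp _ => WeightedFock.mult_eq_fockSpace hω hα hq hqp,
    fun p q hq hqp => by
      rw [WeightedFock.mult_eq_fockSpace hω hα hq hqp, sub_self,
        WeightedFock.fockSpace_zero_eq hω.isWeight
          (div_pos (mul_pos (hq.trans hqp) hq) (sub_pos.2 hqp))]⟩
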